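/- **Setting.** Let $\mathcal H,\mathcal V$ be real Hilbert spaces, $\mathcal V$ densely and continuously embedded in $\mathcal H$, so that $\mathcal V\hookrightarrow\mathcal H=\mathcal H'\hookrightarrow\mathcal V'$, with duality pairing $\langle\cdot,\cdot\rangle$. Let $J\ge 1$ and, for $1\le j\le J$, let $X_j$ be a metric space with a finite measure $\mu_j$ (open sets being measurable), let $N_j\ge1$, and let $U_j$ be a closed subspace of $L^2(X_j,\mu_j)^{N_j}$. Let $U=\prod_{j=1}^J U_j$, and let $I_U:\mathcal V\to U$ be a continuous linear map; as an operator $\mathcal V\to\mathcal V'$, $I_U$ is understood through $\langle I_Uu,v\rangle=(I_Uu,I_Uv)_U$. Let $A_1:\mathcal V\to\mathcal V'$ be bounded and linear with $\langle A_1u,u\rangle=0$ for all $u\in\mathcal V$. Let $\alpha_j\in C([0,\infty)\times X_j;(0,\infty))$ be such that for every $T>0$ there is $\kappa(T)>0$ with $|\alpha_j(t,x)-\alpha_j(s,x)|\le\kappa(T)|t-s|$ for $s,t\in[0,T]$, $x\in X_j$. Let $g_j:\mathbb R^{N_j}\to\mathbb R^{N_j}$ be continuous with $(g_j(x)-g_j(y))\cdot(x-y)\ge0$,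 $g_j(0)=0$ and $|g_j(x)|\le M(1+|x|)$, for some $M>0$. Define $B(t):\mathcal V\to\mathcal V'$ by $$\langle B(t)u,v\rangle=\sum_{j=1}^J\int_{X_j}\alpha_j(t,x_j)\,g_j((I_Uu)_j(x_j))\cdot(I_Uv)_j(x_j)\,d\mu_j(x_j).$$ A *solution* is a function $x\in C([0,\infty);\mathcal H)$ such that for all $t\ge0$, $x(t)\in D(\mathcal A_B(t)):=\{v\in\mathcal V:(A_1+B(t))v\in\mathcal H\}$, and such that $x'(t)=-(A_1+B(t))x(t)$ exists in $\mathcal H$ and is continuous except at a countable number of points $t$. Its energy is $\mathcal E(t)=\frac12\|x(t)\|_{\mathcal H}^2$. **Assumptions.** * The part of $A_1-I_U$ in $\mathcal H$ generates a $C_0$-semigroup of contractions, and the part of $-A_1-I_U$ generates a $C_0$-semigroup of contractions $S(t)$ with $\|S(t)x_0\|\le Ce^{-\omega t}\|x_0\|$ for all $t\ge0$, $x_0\in\mathcal H$, where $C,\omega>0$. * There are $m>0$ and a concave, strictly increasing $G:[0,\infty)\to[0,\infty)$ with $G(0)=0$ such that for all $j$: $g_j(x)\cdot x\ge m|x|^2$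 if $|x|\ge1$, and $|x|^2+|g_j(x)|^2\le G(g_j(x)\cdot x)$ if $|x|\le1$. Moreover there are $\delta\ge2$, $C_G>0$ with $\beta^2G(x)\le C_GG(\beta^\delta x)$ for all $x,\beta>0$. * For all $j$ and $x_j\in X_j$, $t\mapsto\alpha_j(t,x_j)$ is non-decreasing; $\alpha(t):=\max_j\sup_{x_j}\alpha_j(t,x_j)<\infty$ for all $t\ge0$; $\alpha(0)>0$; and there is $c_0\in(0,1]$ with $c_0\alpha(t)\le\alpha_j(t,x_j)\le\alpha(t)$ for all $t\ge0$, $j$, $x_j$. **Theorem.** For every sufficiently large $T>0$ (the threshold depending only on $C,\omega$) there is $c>0$, depending only on $T$, $C$, $\omega$, $J$, $\max_j\mu_j(X_j)$, $\alpha(0)$, $c_0$, $M$, $m$, $\delta$, $C_G$, such that every solution satisfies $$\mathcal E(t)\le\psi^{-1}\Big(T\mu c_0\int_T^t\alpha(s-T)\,\alpha(s)^{-\delta}\,ds\Big)\qquad\forall t\ge T,$$ where $\mu=\min_j\mu_j(X_j)$, $h(x)=c(x+G(x))$ is a bijection of $[0,\infty)$, $p=h^{-1}$, and $\psi(x)=\int_x^{\mathcal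 E(0)}\frac{ds}{p(s)}$, which maps $(0,\mathcal E(0)]$ bijectively onto $[0,\infty)$ if $\mathcal E(0)>0$ (if $\mathcal E(0)=0$, the right-hand side is read as $0$); all these integrals exist. In particular, let $\mu>0$ and $\alpha(t)=(1+t)^\sigma$ with $\sigma>0$. If $\sigma\le\frac1{\delta-1}$, then $\mathcal E(t)\to0$ as $t\to\infty$ for every solution. If $\sigma<\frac1{\delta-1}$, or if $\delta=2$ and $\sigma=1$, then there are $r>0$ and, for each value $\mathcal E(0)$, a constant $K(\mathcal E(0))>0$ such that $\mathcal E(t)\le K(\mathcal E(0))\,t^{-r}$ for all $t\ge T$ and every solution with that initial energy. -/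

import Mathlib

open Set Filter Topology MeasureTheory

universe u v w

noncomputable section

namespace Damping

/-! ### Contraction semigroups and their generators -/

section Semigroup

variable {H : Type*} [NormedAddCommGroup H] [InnerProductSpace ℝ H]

/-- `S` (restricted to `[0,∞)`) is a strongly continuous semigroup of contractions on `H`. -/
structure IsContractionSemigroup (S : ℝ → H →L[ℝ] H) : Prop where
  zero : S 0 = ContinuousLinearMap.id ℝ H
  add : ∀ s t : ℝ, 0 ≤ s → 0 ≤ t → S (s + t) = (S s).comp (S t)
  norm_le : ∀ t : ℝ, 0 ≤ t → ‖S t‖ ≤ 1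
  continuousOn : ∀ x : H, ContinuousOn (fun t => S t x) (Ici 0)

/-- The (single-valued) operator with graph `R ⊆ H × H` is the infinitesimal generator of `S`:
`R x y` holds exactly when `(S t x - x) / t → y` as `t → 0+`. -/
def IsGenerator (R : H → H → Prop) (S : ℝ → H →L[ℝ] H) : Prop :=
  ∀ x y : H, R x y ↔ Tendsto (fun t : ℝ => t⁻¹ • (S t x - x)) (𝓝[>] 0) (𝓝 y)

end Semigroup

/-! ### The abstract evolution equation -/

/-- The data of the evolution equation `x'(t) + A₁ x(t) + B(t) x(t) = 0` in `H`:
the embedding `ι` of `V` into `H`, the control space `U = ∏ U_j` with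
`U_j ⊆ L²(X_j, μ_j)^{N_j}`, the map `I_U : V → U`, the linear operator `A₁ : V → V'`
and the feedback coefficients `α_j`, `g_j`. The laws are in `DampedSystem.Standing`. -/
structure DampedSystem (H V : Type*) [NormedAddCommGroup H] [InnerProductSpace ℝ H]
    [NormedAddCommGroup V] [InnerProductSpace ℝ V]
    {J : ℕ} (X : Fin J → Type*) [∀ j, MetricSpace (X j)] [∀ j, MeasurableSpace (X j)] where
  ι : V →L[ℝ] H
  μ : ∀ j, Measure (X j)
  N : Fin J → ℕ
  U : ∀ j, Submodule ℝ (Lp (EuclideanSpace ℝ (Fin (N j))) 2 (μ j))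
  IU : V →L[ℝ] PiLp 2 (fun j => U j)
  A₁ : V →L[ℝ] StrongDual ℝ V
  α : ∀ j, ℝ → X j → ℝ
  g : ∀ j, EuclideanSpace ℝ (Fin (N j)) → EuclideanSpace ℝ (Fin (N j))

namespace DampedSystem

variable {H V : Type*} [NormedAddCommGroup H] [InnerProductSpace ℝ H]
  [NormedAddCommGroup V] [InnerProductSpace ℝ V]
  {J : ℕ} {X : Fin J → Type*} [∀ j, MetricSpace (X j)] [∀ j, MeasurableSpace (X j)]

/-- The standing assumptions on the setting; `M` is the growth constant of the `g_j`. -/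
structure Standing (S : DampedSystem H V X) (M : ℝ) : Prop where
  ι_injective : Function.Injective S.ι
  ι_dense : DenseRange S.ι
  finite : ∀ j, IsFiniteMeasure (S.μ j)
  N_pos : ∀ j, 1 ≤ S.N j
  U_closed : ∀ j, IsClosed (S.U j : Set (Lp (EuclideanSpace ℝ (Fin (S.N j))) 2 (S.μ j)))
  α_continuous : ∀ j,
    ContinuousOn (fun q : ℝ × X j => S.α j q.1 q.2) (Ici (0 : ℝ) ×ˢ (univ : Set (X j)))
  α_pos : ∀ j t x, 0 ≤ t → 0 < S.α j t x
  α_lipschitz : ∀ j, ∀ T > 0, ∃ κ > 0, ∀ s ∈ Icc (0 : ℝ) T, ∀ t ∈ Icc (0 : ℝ) T, ∀ x,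
    |S.α j t x - S.α j s x| ≤ κ * |t - s|
  g_continuous : ∀ j, Continuous (S.g j)
  g_monotone : ∀ j x y, 0 ≤ inner ℝ (S.g j x - S.g j y) (x - y)
  g_zero : ∀ j, S.g j 0 = 0
  g_growth : ∀ j x, ‖S.g j x‖ ≤ M * (1 + ‖x‖)
  A₁_skew : ∀ u, S.A₁ u u = 0

/-- The nonlinear operator `B(t) : V → V'`, as `⟨B(t) u, v⟩`. -/
def B (S : DampedSystem H V X) (t : ℝ) (u v : V) : ℝ :=
  ∑ j, ∫ x, S.α j t x *
    inner ℝ (S.g j ((S.IU u j : Lp (EuclideanSpace ℝ (Fin (S.N j))) 2 (S.μ j)) x))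
      ((S.IU v j : Lp (EuclideanSpace ℝ (Fin (S.N j))) 2 (S.μ j)) x) ∂(S.μ j)

/-- The part in `H` of an operator `L : V → V'` (given as `L v w = ⟨L v, w⟩`), as a graph:
`x = ι v` for some `v : V` and the functional `L v` is represented by `y : H`. -/
def PartGraph (S : DampedSystem H V X) (L : V → V → ℝ) (x y : H) : Prop :=
  ∃ v : V, S.ι v = x ∧ ∀ w : V, L v w = inner ℝ y (S.ι w)

/-- `x` belongs to the domain of `A₁ + B(t)` in `H`, and `(A₁ + B(t)) x = y`. -/
def AB (S : DampedSystem H V X) (t : ℝ) (x y : H) : Prop :=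
  S.PartGraph (fun v w => S.A₁ v w + S.B t v w) x y

/-- The part in `H` of `A₁ - I_U`, where `⟨I_U u, v⟩ = (I_U u, I_U v)_U`. -/
def APlus (S : DampedSystem H V X) : H → H → Prop :=
  S.PartGraph (fun v w => S.A₁ v w - inner ℝ (S.IU v) (S.IU w))

/-- The part in `H` of `-A₁ - I_U`. -/
def AMinus (S : DampedSystem H V X) : H → H → Prop :=
  S.PartGraph (fun v w => -S.A₁ v w - inner ℝ (S.IU v) (S.IU w))

/-- `x : [0,∞) → H` is continuous, `x(t)` lies in the domain of `A₁ + B(t)` for all `t ≥ 0`,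
and, outside a countable set of times, `x'(t) = -(A₁ + B(t)) x(t)` exists in `H` and is
continuous. -/
def IsSolution (S : DampedSystem H V X) (x : ℝ → H) : Prop :=
  ContinuousOn x (Ici 0) ∧
  ∃ y : ℝ → H, (∀ t, 0 ≤ t → S.AB t (x t) (y t)) ∧
    ∃ Z : Set ℝ, Z.Countable ∧ ∀ t ∈ Ici (0 : ℝ) \ Z,
      HasDerivWithinAt x (-y t) (Ici 0) t ∧ ContinuousWithinAt y (Ici 0 \ Z) t

/-- Both `A₁ - I_U` and `-A₁ - I_U` generate contraction semigroups on `H`, and the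
semigroup of the latter is exponentially stable with constants `C`, `ω`. -/
def StableGeneration (S : DampedSystem H V X) (C ω : ℝ) : Prop :=
  (∃ R : ℝ → H →L[ℝ] H, IsContractionSemigroup R ∧ IsGenerator S.APlus R) ∧
  ∃ R : ℝ → H →L[ℝ] H, IsContractionSemigroup R ∧ IsGenerator S.AMinus R ∧
    ∀ t : ℝ, 0 ≤ t → ∀ x₀ : H, ‖R t x₀‖ ≤ C * Real.exp (-ω * t) * ‖x₀‖

/-- `α(t) = max_j sup_x α_j(t,x)`. -/
def alpha (S : DampedSystem H V X) (t : ℝ) : ℝ := ⨆ j, ⨆ x, S.α j t x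

/-- `max_j μ_j(X_j)`. -/
def muMax (S : DampedSystem H V X) : ℝ := ⨆ j, (S.μ j).real univ

/-- `μ = min_j μ_j(X_j)`. -/
def muMin (S : DampedSystem H V X) : ℝ := ⨅ j, (S.μ j).real univ

/-- The assumptions on the time dependence of the `α_j` in the non-decreasing case. -/
structure NonDecreasing (S : DampedSystem H V X) (c₀ : ℝ) : Prop where
  monotone : ∀ j x, MonotoneOn (fun t => S.α j t x) (Ici 0)
  bddAbove : ∀ t, 0 ≤ t → ∀ j, BddAbove (range (S.α j t))
  alpha_zero_pos : 0 < S.alpha 0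
  comparable : ∀ t, 0 ≤ t → ∀ j x, c₀ * S.alpha t ≤ S.α j t x ∧ S.α j t x ≤ S.alpha t

end DampedSystem

/-- The energy `E(t) = ‖x(t)‖² / 2`. -/
def energy {H : Type*} [NormedAddCommGroup H] (x : ℝ → H) (t : ℝ) : ℝ := ‖x t‖ ^ 2 / 2

/-- `G` is concave and strictly increasing on `[0,∞)`, `G 0 = 0`, and
`β² G(x) ≤ C_G G(β^δ x)` for all `x, β > 0`. -/
structure IsGrowthFunction (G : ℝ → ℝ) (δ CG : ℝ) : Prop where
  concave : ConcaveOn ℝ (Ici 0) G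
  strictMono : StrictMonoOn G (Ici 0)
  zero : G 0 = 0
  scaling : ∀ x β : ℝ, 0 < x → 0 < β → β ^ 2 * G x ≤ CG * G (β ^ δ * x)

/-- `g(x) · x ≥ m |x|²` for `|x| ≥ 1`, and `|x|² + |g(x)|² ≤ G(g(x) · x)` for `|x| ≤ 1`. -/
structure IsControlledBy {n : ℕ} (g : EuclideanSpace ℝ (Fin n) → EuclideanSpace ℝ (Fin n))
    (m : ℝ) (G : ℝ → ℝ) : Prop where
  large : ∀ x, 1 ≤ ‖x‖ → m * ‖x‖ ^ 2 ≤ inner ℝ (g x) x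
  small : ∀ x, ‖x‖ ≤ 1 → ‖x‖ ^ 2 + ‖g x‖ ^ 2 ≤ G (inner ℝ (g x) x)

/-- `h(x) = c (x + G(x))`. -/
def hFun (c : ℝ) (G : ℝ → ℝ) (x : ℝ) : ℝ := c * (x + G x)

/-- `p = h⁻¹` on `[0,∞)`. -/
def pFun (c : ℝ) (G : ℝ → ℝ) : ℝ → ℝ := Function.invFunOn (hFun c G) (Ici 0)

/-- `ψ(x) = ∫_x^{E₀} ds / p(s)`. -/
def psi (c : ℝ) (G : ℝ → ℝ) (E₀ x : ℝ) : ℝ := ∫ s in x..E₀, 1 / pFun c G s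

/-- `ψ⁻¹ : [0,∞) → (0,E₀]` if `E₀ > 0`, and `0` by convention if `E₀ = 0`. -/
def psiInv (c : ℝ) (G : ℝ → ℝ) (E₀ v : ℝ) : ℝ :=
  if E₀ = 0 then 0 else Function.invFunOn (psi c G E₀) (Ioc 0 E₀) v

end Damping

end

/-! The undamped flow is conservative, so energy is lost only through the feedback, and the task is
to bound the energy at time `s` by the loss on `[s, s + T]`. Duality with the stable linear
semigroup does this. Let `z` solve `z' = -A₁ z - I_U z` with `z(s) = z₀`. In the derivative of `(x,
z)` the skew terms cancel, leaving `-(B(r) x, z) - (I_U z, I_U x)`. Young's inequality splits this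
into half of `‖I_U z‖²`, whose integral the energy identity for `z` bounds by `‖z₀‖² / 2`, and an
observation of `x` by `‖I_U x‖² + ‖α g(I_U x)‖²`. If `‖z(s + T)‖ ≤ ‖z₀‖ / 4`, the choice `z₀ =
x(s)`, reached by density of the generator's domain, leaves `E(s)` below the integrated observation
(`IsSolutionWith.inner_le`, `IsSolutionWith.observability`).

The observation is bounded by the dissipation `F`: `norm_sq_add_le` pointwise, Jensen's inequality
on each `X_j`, then Jensen in time. Scaling of `G` turns the factor `α²` into `α^δ` inside `G`, and
one power of `α` is already contained in `F`. With `Y` proportional to `α(s + T)^(δ - 1) (E(s) - E(s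
+ T))` this gives `E(s) ≤ h(Y)`, that is, `p(E(s)) T² μ c₀ α(s + T)^(1 - δ) ≤ E(s) - E(s + T)`
(`IsSolutionWith.pFun_energy_le`).

This is a discrete form of `E' ≤ -α^(1 - δ) p(E)`. Since `1 / p` decreases, each period raises
`ψ(E)` by at least the corresponding part of the rate integral; summing gives
`IsSolutionWith.rate_le_psi`, and inverting `ψ` gives the theorem. For power laws the rate integral
diverges logarithmically or like a power, and `p(s) ≥ k s^(δ/2)` near `0` turns this into decay of
`E`. -/

noncomputable section

namespace Damping

/-! ### Growth functions: power bound, continuity, Jensen's inequality. -/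

namespace IsGrowthFunction

variable {G : ℝ → ℝ} {δ CG : ℝ}

theorem nonneg (hG : IsGrowthFunction G δ CG) {x : ℝ} (hx : 0 ≤ x) : 0 ≤ G x := by
  rw [← hG.zero]
  exact hG.strictMono.monotoneOn self_mem_Ici hx hx

theorem mono (hG : IsGrowthFunction G δ CG) {x y : ℝ} (hx : 0 ≤ x) (hxy : x ≤ y) : G x ≤ G y :=
  hG.strictMono.monotoneOn hx (hx.trans hxy) hxy

/-- A concave function vanishing at `0` satisfies `G (k x) ≤ k G(x)` for `k ≥ 1`. -/
theorem map_mul_le (hG : IsGrowthFunction G δ CG) {k x : ℝ} (hk : 1 ≤ k) (hx : 0 ≤ x) :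
    G (k * x) ≤ k * G x := by
  have hk0 : 0 < k := by linarith
  have hm : k * x ∈ Ici (0 : ℝ) := mem_Ici.2 (by positivity)
  have ha : 0 ≤ 1 - 1 / k := by rw [sub_nonneg, div_le_one hk0]; exact hk
  have hb : 0 ≤ 1 / k := by positivity
  have h := hG.concave.2 (self_mem_Ici (a := (0 : ℝ))) hm ha hb (by ring)
  simp only [smul_eq_mul, hG.zero, mul_zero, zero_add] at h
  have e : 1 / k * (k * x) = x := by field_simp
  rw [e, div_mul_eq_mul_div, one_mul, div_le_iff₀ hk0] at h
  linarith

/-- The scaling inequality with `β = x^(-1/δ)`, for which `β^δ x = 1`. -/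
theorem le_rpow (hG : IsGrowthFunction G δ CG) (hδ : 0 < δ) {x : ℝ} (hx : 0 < x) :
    G x ≤ CG * G 1 * x ^ (2 / δ) := by
  have hb : 0 < x ^ (-1 / δ) := Real.rpow_pos_of_pos hx _
  have h := hG.scaling x _ hx hb
  have e1 : (x ^ (-1 / δ)) ^ δ * x = 1 := by
    rw [← Real.rpow_mul hx.le, div_mul_cancel₀ _ hδ.ne', Real.rpow_neg_one,
      inv_mul_cancel₀ hx.ne']
  have e2 : (x ^ (-1 / δ)) ^ 2 = (x ^ (2 / δ))⁻¹ := by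
    rw [← Real.rpow_natCast, ← Real.rpow_mul hx.le, ← Real.rpow_neg hx.le]
    congr 1
    push_cast
    ring
  rw [e1, e2, inv_mul_le_iff₀ (Real.rpow_pos_of_pos hx _)] at h
  linarith

/-- Concavity gives continuity only in the interior; a jump at `0` is excluded by the power bound
`le_rpow`. -/
theorem continuousOn (hG : IsGrowthFunction G δ CG) (hδ : 0 < δ) : ContinuousOn G (Ici 0) := by
  intro x hx
  rcases eq_or_lt_of_le (mem_Ici.1 hx) with rfl | hx
  · have h1 : Tendsto (fun x : ℝ => CG * G 1 * x ^ (2 / δ)) (𝓝[≥] 0) (𝓝 0) := by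
      have : Tendsto (fun x : ℝ => CG * G 1 * x ^ (2 / δ)) (𝓝 0) (𝓝 (CG * G 1 * 0 ^ (2 / δ))) :=
        ((Real.continuousAt_rpow_const 0 (2 / δ) (Or.inr (by positivity))).tendsto).const_mul _
      rw [Real.zero_rpow (by positivity), mul_zero] at this
      exact this.mono_left nhdsWithin_le_nhds
    rw [ContinuousWithinAt, hG.zero]
    refine squeeze_zero' ?_ ?_ h1
    · filter_upwards [self_mem_nhdsWithin] with y hy using hG.nonneg hy
    · filter_upwards [self_mem_nhdsWithin] with y hy
      rcases eq_or_lt_of_le (mem_Ici.1 hy) with rfl | hy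
      · rw [hG.zero, Real.zero_rpow (by positivity), mul_zero]
      · exact hG.le_rpow hδ hy
  · have := hG.concave.continuousOn_interior
    rw [interior_Ici] at this
    exact (this.continuousAt (Ioi_mem_nhds hx)).continuousWithinAt

theorem le_affine (hG : IsGrowthFunction G δ CG) {x : ℝ} (hx : 0 ≤ x) : G x ≤ G 1 * (1 + x) := by
  have h := hG.map_mul_le (k := 1 + x) (x := 1) (by linarith) zero_le_one
  have := hG.mono hx (y := (1 + x) * 1) (by linarith)
  linarith

/-- Jensen's inequality on a finite measure space, with an upper bound for the integral. -/
theorem integral_comp_le (hG : IsGrowthFunction G δ CG) (hδ : 0 < δ) {Ω : Type*}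
    [MeasurableSpace Ω] (ν : Measure Ω) [IsFiniteMeasure ν] {f : Ω → ℝ} (hf : Integrable f ν)
    (hf0 : ∀ᵐ x ∂ν, 0 ≤ f x) {m : ℝ} (hm : 0 < m) (hmν : m ≤ ν.real univ) {I : ℝ}
    (hI : ∫ x, f x ∂ν ≤ I) :
    Integrable (fun x => G (f x)) ν ∧ ∫ x, G (f x) ∂ν ≤ ν.real univ * G (I / m) := by
  have hG1 := hG.nonneg zero_le_one
  have hν : 0 < ν.real univ := hm.trans_le hmν
  have hint : Integrable (fun x => G (f x)) ν := by
    refine Integrable.mono' (((integrable_const (1 : ℝ)).add hf).const_mul (G 1)) ?_ ?_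
    · have hc : Continuous (fun x : ℝ => G (max x 0)) :=
        (hG.continuousOn hδ).comp_continuous (by fun_prop) fun x => mem_Ici.2 (le_max_right _ _)
      refine (hc.comp_aestronglyMeasurable hf.1).congr ?_
      filter_upwards [hf0] with x hx
      simp [max_eq_left hx]
    · filter_upwards [hf0] with x hx
      rw [Real.norm_of_nonneg (hG.nonneg hx)]
      exact hG.le_affine hx
  refine ⟨hint, ?_⟩
  have : NeZero ν := ⟨fun h => by simp [h] at hν⟩
  have h := hG.concave.le_map_average (hG.continuousOn hδ) isClosed_Ici (μ := ν) (f := f)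
    (by filter_upwards [hf0] with x hx using hx) hf hint
  simp only [average_eq, smul_eq_mul] at h
  rw [inv_mul_le_iff₀ hν] at h
  refine h.trans (mul_le_mul_of_nonneg_left ?_ hν.le)
  have h0 : 0 ≤ ∫ x, f x ∂ν := integral_nonneg_of_ae hf0
  refine hG.mono (by positivity) ?_
  rw [inv_mul_eq_div]
  exact (div_le_div_of_nonneg_left h0 hm hmν).trans (by gcongr)

end IsGrowthFunction

/-! ### The functions `h`, `p = h⁻¹` and `ψ`. -/

section Inverse

variable {G : ℝ → ℝ} {δ CG c : ℝ}

theorem hFun_strictMonoOn (hG : IsGrowthFunction G δ CG) (hc : 0 < c) :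
    StrictMonoOn (hFun c G) (Ici 0) := fun x hx y hy hxy => by
  have := hG.strictMono hx hy hxy
  unfold hFun
  gcongr

theorem hFun_zero (hG : IsGrowthFunction G δ CG) : hFun c G 0 = 0 := by simp [hFun, hG.zero]

theorem mul_le_hFun (hG : IsGrowthFunction G δ CG) (hc : 0 < c) {x : ℝ} (hx : 0 ≤ x) :
    c * x ≤ hFun c G x := by
  have := hG.nonneg hx
  unfold hFun
  gcongr
  linarith

theorem hFun_continuousOn (hG : IsGrowthFunction G δ CG) (hδ : 0 < δ) :
    ContinuousOn (hFun c G) (Ici 0) :=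
  continuousOn_const.mul (continuousOn_id.add (hG.continuousOn hδ))

theorem hFun_bijOn (hG : IsGrowthFunction G δ CG) (hδ : 0 < δ) (hc : 0 < c) :
    BijOn (hFun c G) (Ici 0) (Ici 0) := by
  refine ⟨fun x hx => ?_, (hFun_strictMonoOn hG hc).injOn, fun y hy => ?_⟩
  · exact (mul_nonneg hc.le hx).trans (mul_le_hFun hG hc hx)
  · have hy' : 0 ≤ y := hy
    have h := intermediate_value_Icc (a := 0) (b := y / c) (by positivity)
      ((hFun_continuousOn (c := c) hG hδ).mono Icc_subset_Ici_self)
    have hmem : y ∈ Icc (hFun c G 0) (hFun c G (y / c)) := by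
      refine ⟨by rwa [hFun_zero hG], ?_⟩
      have := mul_le_hFun hG hc (x := y / c) (by positivity)
      rwa [mul_div_cancel₀ _ hc.ne'] at this
    obtain ⟨x, hx, rfl⟩ := h hmem
    exact ⟨x, hx.1, rfl⟩

theorem pFun_nonneg (hG : IsGrowthFunction G δ CG) (hδ : 0 < δ) (hc : 0 < c) {y : ℝ}
    (hy : 0 ≤ y) : 0 ≤ pFun c G y :=
  Function.invFunOn_mem ((hFun_bijOn hG hδ hc).surjOn hy)

theorem hFun_pFun (hG : IsGrowthFunction G δ CG) (hδ : 0 < δ) (hc : 0 < c) {y : ℝ}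
    (hy : 0 ≤ y) : hFun c G (pFun c G y) = y :=
  Function.invFunOn_eq ((hFun_bijOn hG hδ hc).surjOn hy)

theorem pFun_le_iff (hG : IsGrowthFunction G δ CG) (hδ : 0 < δ) (hc : 0 < c) {x y : ℝ}
    (hy : 0 ≤ y) (hx : 0 ≤ x) : pFun c G y ≤ x ↔ y ≤ hFun c G x := by
  rw [← (hFun_strictMonoOn hG hc).le_iff_le (pFun_nonneg hG hδ hc hy) hx, hFun_pFun hG hδ hc hy]

theorem le_pFun_iff (hG : IsGrowthFunction G δ CG) (hδ : 0 < δ) (hc : 0 < c) {x y : ℝ}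
    (hy : 0 ≤ y) (hx : 0 ≤ x) : x ≤ pFun c G y ↔ hFun c G x ≤ y := by
  rw [← (hFun_strictMonoOn hG hc).le_iff_le hx (pFun_nonneg hG hδ hc hy), hFun_pFun hG hδ hc hy]

theorem pFun_pos (hG : IsGrowthFunction G δ CG) (hδ : 0 < δ) (hc : 0 < c) {y : ℝ}
    (hy : 0 < y) : 0 < pFun c G y := by
  by_contra! h
  rw [pFun_le_iff hG hδ hc hy.le le_rfl, hFun_zero hG] at h
  linarith

theorem pFun_mono (hG : IsGrowthFunction G δ CG) (hδ : 0 < δ) (hc : 0 < c) {x y : ℝ}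
    (hx : 0 ≤ x) (hxy : x ≤ y) : pFun c G x ≤ pFun c G y := by
  rwa [pFun_le_iff hG hδ hc hx (pFun_nonneg hG hδ hc (hx.trans hxy)),
    hFun_pFun hG hδ hc (hx.trans hxy)]

theorem pFun_le_div (hG : IsGrowthFunction G δ CG) (hδ : 0 < δ) (hc : 0 < c) {y : ℝ}
    (hy : 0 ≤ y) : pFun c G y ≤ y / c := by
  rw [pFun_le_iff hG hδ hc hy (by positivity)]
  have := mul_le_hFun hG hc (x := y / c) (by positivity)
  rwa [mul_div_cancel₀ _ hc.ne'] at this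

/-- `p(s) ≥ k s^{δ/2}` on `(0, h(1)]`. -/
theorem exists_rpow_le_pFun (hG : IsGrowthFunction G δ CG) (hδ : 2 ≤ δ) (hCG : 0 < CG)
    (hc : 0 < c) : ∃ k > 0, ∀ s, 0 < s → s ≤ hFun c G 1 → k * s ^ (δ / 2) ≤ pFun c G s := by
  have hδ0 : 0 < δ := by linarith
  have hG1 := hG.nonneg zero_le_one
  set K := c * (1 + CG * G 1) with hK
  have hK0 : 0 < K := by positivity
  refine ⟨(K ^ (δ / 2))⁻¹, by positivity, fun s hs hs1 => ?_⟩
  have hp := pFun_pos hG hδ0 hc hs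
  have hp1 : pFun c G s ≤ 1 := by rwa [pFun_le_iff hG hδ0 hc hs.le zero_le_one]
  have h1 : s ≤ K * pFun c G s ^ (2 / δ) := by
    conv_lhs => rw [← hFun_pFun hG hδ0 hc hs.le]
    have h2 := hG.le_rpow hδ0 hp
    have h3 : pFun c G s ≤ pFun c G s ^ (2 / δ) := by
      conv_lhs => rw [← Real.rpow_one (pFun c G s)]
      exact Real.rpow_le_rpow_of_exponent_ge hp hp1 (by rw [div_le_one hδ0]; exact hδ)
    unfold hFun
    rw [hK, mul_assoc]
    gcongr
    linarith
  have h4 := Real.rpow_le_rpow hs.le h1 (z := δ / 2) (by positivity)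
  rw [Real.mul_rpow hK0.le (by positivity), ← Real.rpow_mul hp.le,
    show 2 / δ * (δ / 2) = 1 by field_simp, Real.rpow_one] at h4
  rw [inv_mul_le_iff₀ (by positivity)]
  exact h4

theorem one_div_pFun_antitoneOn (hG : IsGrowthFunction G δ CG) (hδ : 0 < δ) (hc : 0 < c) :
    AntitoneOn (fun s => 1 / pFun c G s) (Ioi 0) := fun _ hx _ _ hxy =>
  one_div_le_one_div_of_le (pFun_pos hG hδ hc hx) (pFun_mono hG hδ hc (mem_Ioi.1 hx).le hxy)

theorem intervalIntegrable_one_div_pFun (hG : IsGrowthFunction G δ CG) (hδ : 0 < δ) (hc : 0 < c)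
    {x y : ℝ} (hx : 0 < x) (hy : 0 < y) :
    IntervalIntegrable (fun s => 1 / pFun c G s) volume x y := by
  refine AntitoneOn.intervalIntegrable ((one_div_pFun_antitoneOn hG hδ hc).mono fun s hs => ?_)
  exact (lt_min hx hy).trans_le hs.1

variable {E₀ : ℝ}

theorem psi_sub_psi (hG : IsGrowthFunction G δ CG) (hδ : 0 < δ) (hc : 0 < c)
    {x y : ℝ} (hx : 0 < x) (hy : 0 < y) (hE : 0 < E₀) :
    psi c G E₀ x - psi c G E₀ y = ∫ s in x..y, 1 / pFun c G s := by
  rw [psi, psi, sub_eq_iff_eq_add]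
  exact (intervalIntegral.integral_add_adjacent_intervals
    (intervalIntegrable_one_div_pFun hG hδ hc hx hy)
    (intervalIntegrable_one_div_pFun hG hδ hc hy hE)).symm

/-- The integrand `1 / p` is decreasing, so its smallest value on `[x, y]` is at `y`. This turns an
energy drop into an increase of `ψ`. -/
theorem div_pFun_le_psi_sub_psi (hG : IsGrowthFunction G δ CG) (hδ : 0 < δ) (hc : 0 < c)
    {x y : ℝ} (hx : 0 < x) (hxy : x ≤ y) (hE : 0 < E₀) :
    (y - x) / pFun c G y ≤ psi c G E₀ x - psi c G E₀ y := by
  have hy := hx.trans_le hxy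
  rw [psi_sub_psi hG hδ hc hx hy hE]
  have h := intervalIntegral.integral_mono_on hxy intervalIntegrable_const
    (intervalIntegrable_one_div_pFun hG hδ hc hx hy) (f := fun _ => 1 / pFun c G y)
    fun s hs => one_div_pFun_antitoneOn hG hδ hc (hx.trans_le hs.1) hy hs.2
  rw [intervalIntegral.integral_const, smul_eq_mul, mul_one_div] at h
  exact h

theorem psi_sub_psi_le_div_pFun (hG : IsGrowthFunction G δ CG) (hδ : 0 < δ) (hc : 0 < c)
    {x y : ℝ} (hx : 0 < x) (hxy : x ≤ y) (hE : 0 < E₀) :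
    psi c G E₀ x - psi c G E₀ y ≤ (y - x) / pFun c G x := by
  have hy := hx.trans_le hxy
  rw [psi_sub_psi hG hδ hc hx hy hE]
  have h := intervalIntegral.integral_mono_on hxy
    (intervalIntegrable_one_div_pFun hG hδ hc hx hy) intervalIntegrable_const
    (g := fun _ => 1 / pFun c G x)
    fun s hs => one_div_pFun_antitoneOn hG hδ hc hx (hx.trans_le hs.1) hs.1
  rw [intervalIntegral.integral_const, smul_eq_mul, mul_one_div] at h
  exact h

theorem psi_self : psi c G E₀ E₀ = 0 := by simp [psi]

theorem psi_strictAntiOn (hG : IsGrowthFunction G δ CG) (hδ : 0 < δ) (hc : 0 < c)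
    (hE : 0 < E₀) : StrictAntiOn (psi c G E₀) (Ioi 0) := fun x hx y hy hxy => by
  have h := div_pFun_le_psi_sub_psi hG hδ hc hx hxy.le hE
  have : 0 < (y - x) / pFun c G y := div_pos (sub_pos.2 hxy) (pFun_pos hG hδ hc hy)
  linarith

/-- From `p(s) ≤ s / c`. It forces `ψ` to blow up at `0`, hence its surjectivity onto `[0,∞)`. -/
theorem mul_log_le_psi (hG : IsGrowthFunction G δ CG) (hδ : 0 < δ) (hc : 0 < c)
    {x : ℝ} (hx : 0 < x) (hxE : x ≤ E₀) : c * Real.log (E₀ / x) ≤ psi c G E₀ x := by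
  have hE := hx.trans_le hxE
  rw [← integral_inv_of_pos hx hE, ← intervalIntegral.integral_const_mul]
  refine intervalIntegral.integral_mono_on hxE ?_
    (intervalIntegrable_one_div_pFun hG hδ hc hx hE) fun s hs => ?_
  · refine (intervalIntegral.intervalIntegrable_inv (fun s hs => ?_) continuousOn_id).const_mul c
    exact ((lt_min hx hE).trans_le hs.1).ne'
  · have hs0 := hx.trans_le hs.1
    have h := one_div_le_one_div_of_le (pFun_pos hG hδ hc hs0) (pFun_le_div hG hδ hc hs0.le)
    rwa [one_div_div, div_eq_mul_inv] at h

theorem psi_bijOn (hG : IsGrowthFunction G δ CG) (hδ : 0 < δ) (hc : 0 < c) (hE : 0 < E₀) :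
    BijOn (psi c G E₀) (Ioc 0 E₀) (Ici 0) := by
  refine ⟨fun x hx => ?_, ((psi_strictAntiOn hG hδ hc hE).mono Ioc_subset_Ioi_self).injOn,
    fun v hv => ?_⟩
  · rw [mem_Ici, ← psi_self (c := c) (G := G) (E₀ := E₀)]
    exact (psi_strictAntiOn hG hδ hc hE).antitoneOn hx.1 hE hx.2
  · have hv' : 0 ≤ v := hv
    set x := E₀ * Real.exp (-(v / c)) with hx
    have hx0 : 0 < x := by positivity
    have hxE : x ≤ E₀ := mul_le_of_le_one_right hE.le (by rw [Real.exp_le_one_iff, neg_nonpos]; positivity)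
    have hvx : v ≤ psi c G E₀ x := by
      have h := mul_log_le_psi hG hδ hc hx0 hxE
      rwa [hx, div_mul_cancel_left₀ hE.ne', ← Real.exp_neg, neg_neg, Real.log_exp,
        mul_div_cancel₀ _ hc.ne'] at h
    have hcont : ContinuousOn (psi c G E₀) (Icc x E₀) := by
      have := intervalIntegral.continuousOn_primitive_interval_left (μ := volume) (a := x) (b := E₀)
        (f := fun s => 1 / pFun c G s) (by
          rw [uIcc_of_le hxE, integrableOn_Icc_iff_integrableOn_Ioc,
            ← intervalIntegrable_iff_integrableOn_Ioc_of_le hxE]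
          exact intervalIntegrable_one_div_pFun hG hδ hc hx0 hE)
      rwa [uIcc_of_le hxE] at this
    obtain ⟨y, hy, rfl⟩ := intermediate_value_Icc' hxE hcont ⟨by rwa [psi_self], hvx⟩
    exact ⟨y, ⟨hx0.trans_le hy.1, hy.2⟩, rfl⟩

theorem psiInv_mem (hG : IsGrowthFunction G δ CG) (hδ : 0 < δ) (hc : 0 < c) (hE : 0 < E₀)
    {v : ℝ} (hv : 0 ≤ v) : psiInv c G E₀ v ∈ Ioc 0 E₀ ∧ psi c G E₀ (psiInv c G E₀ v) = v := by
  rw [psiInv, if_neg hE.ne']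
  have h := (psi_bijOn hG hδ hc hE).surjOn hv
  exact ⟨Function.invFunOn_mem h, Function.invFunOn_eq h⟩

theorem le_psiInv_of_le_psi (hG : IsGrowthFunction G δ CG) (hδ : 0 < δ) (hc : 0 < c)
    (hE : 0 < E₀) {v e : ℝ} (hv : 0 ≤ v) (he : 0 < e) (h : v ≤ psi c G E₀ e) :
    e ≤ psiInv c G E₀ v := by
  obtain ⟨h1, h2⟩ := psiInv_mem hG hδ hc hE hv
  rwa [← (psi_strictAntiOn hG hδ hc hE).le_iff_ge h1.1 he, h2]

end Inverse

/-! ### Monotonicity from derivatives off a countable set. -/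

section Countable

/-- A continuous function with negative derivative off a countable set is antitone. -/
theorem le_of_hasDerivAt_neg_off_countable {f f' : ℝ → ℝ} {a b : ℝ} {Z : Set ℝ}
    (hZ : Z.Countable) (hab : a ≤ b) (hf : ContinuousOn f (Icc a b))
    (hd : ∀ t ∈ Ioo a b \ Z, HasDerivAt f (f' t) t) (hneg : ∀ t ∈ Ioo a b \ Z, f' t < 0) :
    f b ≤ f a := by
  by_contra! hlt
  -- The image of `Z` is countable and an interval is not, so some intermediate level `w` is never
  -- taken on `Z`. At the last time with `f ≤ w` the derivative then exists, and it is nonnegative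
  -- because `f > w` afterwards.
  obtain ⟨w, hw, hwZ⟩ : ∃ w ∈ Ioo (f a) (f b), w ∉ f '' Z := by
    by_contra! h
    exact (Cardinal.Real.Ioo_countable_iff.not.2 hlt.not_ge) ((hZ.image f).mono h)
  set s := {t ∈ Icc a b | f t ≤ w} with hs
  have hsc : IsClosed s := hf.preimage_isClosed_of_isClosed isClosed_Icc isClosed_Iic
  have hsb : BddAbove s := ⟨b, fun t ht => ht.1.2⟩
  have hsa : a ∈ s := ⟨left_mem_Icc.2 hab, hw.1.le⟩
  have hmem : sSup s ∈ s := hsc.csSup_mem ⟨a, hsa⟩ hsb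
  set t := sSup s with ht
  have htb : t < b := lt_of_le_of_ne hmem.1.2 fun h => by
    have := hmem.2
    rw [h] at this
    exact absurd hw.2 this.not_gt
  have hgt : ∀ r ∈ Ioc t b, w < f r := fun r hr => by
    by_contra! h
    exact absurd (le_csSup hsb (show r ∈ s from ⟨⟨hmem.1.1.trans hr.1.le, hr.2⟩, h⟩)) hr.1.not_ge
  have hft : f t = w := by
    refine le_antisymm hmem.2 ?_
    have hc : ContinuousWithinAt f (Ioc t b) t :=
      (hf t hmem.1).mono fun r hr => ⟨hmem.1.1.trans hr.1.le, hr.2⟩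
    have : (𝓝[Ioc t b] t).NeBot := by
      rw [nhdsWithin_Ioc_eq_nhdsGT htb]
      infer_instance
    exact ge_of_tendsto hc (by
      filter_upwards [self_mem_nhdsWithin] with r hr using (hgt r hr).le)
  have hat : a < t := lt_of_le_of_ne hmem.1.1 fun h => by
    rw [← h] at hft
    exact absurd hw.1 (by rw [hft]; exact lt_irrefl w)
  have htZ : t ∈ Ioo a b \ Z := ⟨⟨hat, htb⟩, fun h => hwZ ⟨t, h, hft⟩⟩
  have hslope := (hd t htZ).hasDerivWithinAt (s := Ioi t)
  rw [hasDerivWithinAt_iff_tendsto_slope' (by simp)] at hslope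
  have : 0 ≤ f' t := ge_of_tendsto hslope (by
    filter_upwards [Ioc_mem_nhdsGT htb] with r hr
    rw [slope_def_field]
    exact div_nonneg (by rw [hft]; linarith [hgt r hr]) (by linarith [hr.1]))
  linarith [hneg t htZ]

theorem le_of_hasDerivAt_nonpos_off_countable {f f' : ℝ → ℝ} {a b : ℝ} {Z : Set ℝ}
    (hZ : Z.Countable) (hab : a ≤ b) (hf : ContinuousOn f (Icc a b))
    (hd : ∀ t ∈ Ioo a b \ Z, HasDerivAt f (f' t) t) (hneg : ∀ t ∈ Ioo a b \ Z, f' t ≤ 0) :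
    f b ≤ f a := by
  have key : ∀ ε > 0, f b ≤ f a + ε * (b - a) := fun ε hε => by
    have h := le_of_hasDerivAt_neg_off_countable (f := fun t => f t - ε * t)
      (f' := fun t => f' t - ε * 1) hZ hab (hf.sub (by fun_prop))
      (fun t ht => (hd t ht).sub ((hasDerivAt_id t).const_mul ε))
      fun t ht => by linarith [hneg t ht]
    linarith
  have hlim : Tendsto (fun ε : ℝ => f a + ε * (b - a)) (𝓝[>] 0) (𝓝 (f a)) := by
    have : Tendsto (fun ε : ℝ => f a + ε * (b - a)) (𝓝 0) (𝓝 (f a + 0 * (b - a))) :=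
      Continuous.tendsto (by fun_prop) 0
    rw [zero_mul, add_zero] at this
    exact this.mono_left nhdsWithin_le_nhds
  exact ge_of_tendsto hlim (by filter_upwards [self_mem_nhdsWithin] with ε hε using key ε hε)

end Countable

/-! ### Orbits and generators of contraction semigroups. -/

section Semigroup

variable {H : Type*} [NormedAddCommGroup H] [InnerProductSpace ℝ H]
  {S : ℝ → H →L[ℝ] H} {R : H → H → Prop}

theorem IsContractionSemigroup.norm_apply_le (hS : IsContractionSemigroup S) {t : ℝ} (ht : 0 ≤ t)
    (x : H) : ‖S t x‖ ≤ ‖x‖ :=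
  ((S t).le_of_opNorm_le (hS.norm_le t ht) x).trans (one_mul _).le

theorem IsContractionSemigroup.add_apply (hS : IsContractionSemigroup S) {s t : ℝ} (hs : 0 ≤ s)
    (ht : 0 ≤ t) (x : H) : S (s + t) x = S s (S t x) := by
  rw [hS.add s t hs ht, ContinuousLinearMap.comp_apply]

theorem IsContractionSemigroup.zero_apply (hS : IsContractionSemigroup S) (x : H) :
    S 0 x = x := by simp [hS.zero]

theorem IsGenerator.apply (hR : IsGenerator R S) (hS : IsContractionSemigroup S) {x y : H}
    (h : R x y) {t : ℝ} (ht : 0 ≤ t) : R (S t x) (S t y) := by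
  rw [hR] at h ⊢
  have h1 := ((S t).continuous.tendsto y).comp h
  refine h1.congr' ?_
  filter_upwards [self_mem_nhdsWithin] with r hr
  have hr' : 0 ≤ r := (mem_Ioi.1 hr).le
  simp only [Function.comp_apply, map_smul, map_sub]
  rw [← hS.add_apply ht hr', ← hS.add_apply hr' ht, add_comm]

/-- The right derivative is the generator at `S t x`. For the left one, `S t x - S r x = S r (S (t -
r) x - x)`, and contractivity of `S r` together with strong continuity gives the limit. -/
theorem IsGenerator.hasDerivAt (hR : IsGenerator R S) (hS : IsContractionSemigroup S) {x y : H}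
    (h : R x y) {t : ℝ} (ht : 0 < t) : HasDerivAt (fun r => S r x) (S t y) t := by
  have h0 := (hR x y).1 h
  have hright : HasDerivWithinAt (fun r => S r x) (S t y) (Ioi t) t := by
    rw [hasDerivWithinAt_iff_tendsto_slope' (by simp)]
    have h1 := (hR _ _).1 (hR.apply hS h ht.le)
    have h2 : Tendsto (fun r : ℝ => r - t) (𝓝[>] t) (𝓝[>] 0) := by
      refine tendsto_nhdsWithin_iff.2 ⟨?_, ?_⟩
      · have : Tendsto (fun r : ℝ => r - t) (𝓝 t) (𝓝 (t - t)) := Continuous.tendsto (by fun_prop) t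
        rw [sub_self] at this
        exact this.mono_left nhdsWithin_le_nhds
      · filter_upwards [self_mem_nhdsWithin] with r hr using sub_pos.2 (by simpa using hr)
    refine (h1.comp h2).congr' ?_
    filter_upwards [self_mem_nhdsWithin] with r hr
    simp only [Function.comp_apply, slope_def_module]
    rw [← hS.add_apply (sub_nonneg.2 (mem_Ioi.1 hr).le) ht.le, sub_add_cancel]
  have hleft : HasDerivWithinAt (fun r => S r x) (S t y) (Iio t) t := by
    rw [hasDerivWithinAt_iff_tendsto_slope' (by simp)]
    have h2 : Tendsto (fun r : ℝ => t - r) (𝓝[<] t) (𝓝[>] 0) := by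
      refine tendsto_nhdsWithin_iff.2 ⟨?_, ?_⟩
      · have : Tendsto (fun r : ℝ => t - r) (𝓝 t) (𝓝 (t - t)) := Continuous.tendsto (by fun_prop) t
        rw [sub_self] at this
        exact this.mono_left nhdsWithin_le_nhds
      · filter_upwards [self_mem_nhdsWithin] with r hr using sub_pos.2 (by simpa using hr)
    have h1 := h0.comp h2
    have hcy : Tendsto (fun r => S r y) (𝓝[<] t) (𝓝 (S t y)) :=
      ((hS.continuousOn y).continuousAt (Ici_mem_nhds ht)).tendsto.mono_left nhdsWithin_le_nhds
    rw [tendsto_iff_norm_sub_tendsto_zero] at h1 hcy ⊢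
    have h3 := h1.add hcy
    rw [add_zero] at h3
    refine squeeze_zero' (Eventually.of_forall fun _ => norm_nonneg _) ?_ h3
    filter_upwards [Ico_mem_nhdsLT ht] with r hr
    have hr0 : 0 ≤ r := hr.1
    have htr : 0 ≤ t - r := by linarith [hr.2]
    have e : slope (fun r => S r x) t r = S r ((t - r)⁻¹ • (S (t - r) x - x)) := by
      rw [slope_def_module, map_smul, map_sub, ← hS.add_apply hr0 htr, add_sub_cancel,
        ← neg_sub t r, inv_neg, neg_smul, ← smul_neg, neg_sub]
    rw [e]
    calc ‖S r ((t - r)⁻¹ • (S (t - r) x - x)) - S t y‖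
        = ‖S r ((t - r)⁻¹ • (S (t - r) x - x) - y) + (S r y - S t y)‖ := by
          rw [map_sub]; congr 1; abel
      _ ≤ _ := (norm_add_le _ _).trans (by
          gcongr
          exact hS.norm_apply_le hr0 _)
  have := hleft.Iic_of_Iio.union hright.Ici_of_Ioi
  rwa [Iic_union_Ici, hasDerivWithinAt_univ] at this

/-- The averages `h⁻¹ ∫₀ʰ S s x ds` lie in the domain and tend to `x`. -/
theorem IsGenerator.dense [CompleteSpace H] (hR : IsGenerator R S)
    (hS : IsContractionSemigroup S) : Dense {x | ∃ y, R x y} := by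
  intro x
  -- Freezing the orbit at negative times makes it continuous on the whole line, so the fundamental
  -- theorem of calculus applies at `0` too.
  set f : ℝ → H := fun s => S (max s 0) x with hf
  have hfc : Continuous f :=
    (hS.continuousOn x).comp_continuous (by fun_prop) fun s => mem_Ici.2 (le_max_right _ _)
  have hfi : ∀ a b, IntervalIntegrable f volume a b := fun a b => hfc.intervalIntegrable a b
  have hf0 : f 0 = x := by simp [hf, hS.zero_apply]
  set P : ℝ → H := fun h => ∫ s in (0 : ℝ)..h, f s with hP
  have hPd : ∀ h, HasDerivAt P (f h) h := fun h =>
    intervalIntegral.integral_hasDerivAt_right (hfi 0 h) (hfc.stronglyMeasurableAtFilter _ _)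
      hfc.continuousAt
  have hmem : ∀ h, 0 < h → R (P h) (S h x - x) := fun h hh => by
    rw [hR]
    have hd1 := (((hPd (0 + h)).comp_add_const 0 h).sub (hPd 0)).hasDerivWithinAt (s := Ioi 0)
    rw [hasDerivWithinAt_iff_tendsto_slope' (by simp)] at hd1
    have e : f (0 + h) - f 0 = S h x - x := by
      rw [hf0, zero_add]
      simp [hf, max_eq_left hh.le]
    rw [e] at hd1
    refine hd1.congr' ?_
    filter_upwards [self_mem_nhdsWithin] with t ht
    have ht0 : 0 ≤ t := (mem_Ioi.1 ht).le
    rw [slope_def_module]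
    have e1 : S t (P h) = ∫ s in (0 : ℝ)..h, f (s + t) := by
      rw [hP]
      simp only
      rw [← ContinuousLinearMap.intervalIntegral_comp_comm _ (hfi 0 h)]
      refine intervalIntegral.integral_congr fun s hs => ?_
      rw [uIcc_of_le hh.le] at hs
      simp only [hf]
      rw [max_eq_left hs.1, max_eq_left (by linarith [hs.1]), add_comm s t, hS.add_apply ht0 hs.1]
    have e2 : P (t + h) = P t + ∫ s in t..(t + h), f s :=
      (intervalIntegral.integral_add_adjacent_intervals (hfi 0 t) (hfi t _)).symm
    rw [e1, intervalIntegral.integral_comp_add_right]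
    have e3 : P 0 = 0 := by simp [hP]
    simp only [Pi.sub_apply, zero_add, sub_zero]
    rw [e2, e3, add_comm h t]
    congr 1
    abel
  have hlim : Tendsto (fun h : ℝ => h⁻¹ • P h) (𝓝[>] 0) (𝓝 x) := by
    have hd1 := (hPd 0).hasDerivWithinAt (s := Ioi 0)
    rw [hasDerivWithinAt_iff_tendsto_slope' (by simp), hf0] at hd1
    refine hd1.congr fun h => ?_
    rw [slope_def_module]
    simp [hP]
  refine mem_closure_of_tendsto hlim ?_
  filter_upwards [self_mem_nhdsWithin] with h hh
  refine ⟨h⁻¹ • (S h x - x), ?_⟩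
  have := hmem h hh
  rw [hR] at this ⊢
  refine (this.const_smul h⁻¹).congr fun t => ?_
  rw [map_smul, ← smul_sub, smul_comm]

end Semigroup

/-! ### Bounds of the observation by the dissipation, pointwise and integrated. -/

theorem IsControlledBy.norm_sq_add_le {n : ℕ}
    {g : EuclideanSpace ℝ (Fin n) → EuclideanSpace ℝ (Fin n)} {m M δ CG a a₀ b : ℝ} {G : ℝ → ℝ}
    (hg : IsControlledBy g m G) (hG : IsGrowthFunction G δ CG) (hm : 0 < m) (hM : 0 < M)
    (hCG : 0 < CG)
    (hgM : ∀ x, ‖g x‖ ≤ M * (1 + ‖x‖)) (hg0 : ∀ x, 0 ≤ inner ℝ (g x) x)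
    (ha₀ : 0 < a₀) (ha : a₀ ≤ a) (hb0 : 0 ≤ b) (hb : b ≤ a) (x : EuclideanSpace ℝ (Fin n)) :
    ‖x‖ ^ 2 + ‖b • g x‖ ^ 2 ≤ (1 + (a₀ ^ 2)⁻¹) * CG * G (a ^ δ * inner ℝ (g x) x) +
      ((a₀ ^ 2)⁻¹ + 4 * M ^ 2) / m * (a ^ 2 * inner ℝ (g x) x) := by
  have ha0 : 0 < a := ha₀.trans_le ha
  have hgx := hg0 x
  have hGn : 0 ≤ G (a ^ δ * inner ℝ (g x) x) := hG.nonneg (by positivity)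
  have hone : 1 ≤ (a₀ ^ 2)⁻¹ * a ^ 2 := by
    rw [inv_mul_eq_div, one_le_div (by positivity)]
    gcongr
  have hbg : ‖b • g x‖ ^ 2 ≤ a ^ 2 * ‖g x‖ ^ 2 := by
    rw [norm_smul, Real.norm_of_nonneg hb0, mul_pow]
    gcongr
  have hx1 : ‖x‖ ^ 2 ≤ (a₀ ^ 2)⁻¹ * a ^ 2 * ‖x‖ ^ 2 := le_mul_of_one_le_left (by positivity) hone
  -- For small `x` the factor `a²` is moved inside `G` by scaling with `β = a`. For large `x`,
  -- linear growth and coercivity make everything comparable to `g(x) · x`.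
  rcases le_total ‖x‖ 1 with h | h
  · have h1 := hg.small x h
    have h2 : a ^ 2 * G (inner ℝ (g x) x) ≤ CG * G (a ^ δ * inner ℝ (g x) x) := by
      rcases eq_or_lt_of_le hgx with h0 | h0
      · rw [← h0, mul_zero, hG.zero, mul_zero, mul_zero]
      · exact hG.scaling _ _ h0 ha0
    calc ‖x‖ ^ 2 + ‖b • g x‖ ^ 2
        ≤ (1 + (a₀ ^ 2)⁻¹) * (a ^ 2 * (‖x‖ ^ 2 + ‖g x‖ ^ 2)) := by
          have h3 : 0 ≤ (a₀ ^ 2)⁻¹ * (a ^ 2 * ‖g x‖ ^ 2) := by positivity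
          have h4 : 0 ≤ a ^ 2 * ‖x‖ ^ 2 := by positivity
          nlinarith
      _ ≤ (1 + (a₀ ^ 2)⁻¹) * (a ^ 2 * G (inner ℝ (g x) x)) := by gcongr
      _ ≤ (1 + (a₀ ^ 2)⁻¹) * (CG * G (a ^ δ * inner ℝ (g x) x)) := by gcongr
      _ = (1 + (a₀ ^ 2)⁻¹) * CG * G (a ^ δ * inner ℝ (g x) x) := by ring
      _ ≤ _ := le_add_of_nonneg_right (by positivity)
  · have h1 := hg.large x h
    have h2 : ‖g x‖ ^ 2 ≤ 4 * M ^ 2 * ‖x‖ ^ 2 := by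
      have : ‖g x‖ ≤ M * (2 * ‖x‖) := (hgM x).trans (by gcongr; linarith)
      calc ‖g x‖ ^ 2 ≤ (M * (2 * ‖x‖)) ^ 2 := by gcongr
        _ = _ := by ring
    calc ‖x‖ ^ 2 + ‖b • g x‖ ^ 2
        ≤ (a₀ ^ 2)⁻¹ * a ^ 2 * ‖x‖ ^ 2 + a ^ 2 * (4 * M ^ 2 * ‖x‖ ^ 2) :=
          add_le_add hx1 (hbg.trans (by gcongr))
      _ = ((a₀ ^ 2)⁻¹ + 4 * M ^ 2) / m * (a ^ 2 * (m * ‖x‖ ^ 2)) := by field_simp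
      _ ≤ ((a₀ ^ 2)⁻¹ + 4 * M ^ 2) / m * (a ^ 2 * inner ℝ (g x) x) := by gcongr
      _ ≤ _ := le_add_of_nonneg_left (by positivity)

theorem integrable_inner_of_memLp {Ω E : Type*} [MeasurableSpace Ω] {ν : Measure Ω}
    [NormedAddCommGroup E] [InnerProductSpace ℝ E] {f g : Ω → E} (hf : MemLp f 2 ν)
    (hg : MemLp g 2 ν) : Integrable (fun x => inner ℝ (f x) (g x)) ν := by
  refine (hf.norm.integrable_mul hg.norm).mono' (hf.1.inner hg.1) (Eventually.of_forall fun x => ?_)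
  exact norm_inner_le_norm _ _

namespace DampedSystem

variable {H V : Type*} [NormedAddCommGroup H] [InnerProductSpace ℝ H]
  [NormedAddCommGroup V] [InnerProductSpace ℝ V]
  {J : ℕ} {X : Fin J → Type*} [∀ j, MetricSpace (X j)] [∀ j, MeasurableSpace (X j)]
  {S : DampedSystem H V X} {M m δ CG c₀ t : ℝ} {G : ℝ → ℝ}

theorem NonDecreasing.alpha_mono (hN : S.NonDecreasing c₀) : MonotoneOn S.alpha (Ici 0) := by
  intro s hs t ht hst
  refine ciSup_mono (finite_range _).bddAbove fun j => ?_
  rcases isEmpty_or_nonempty (X j) with hX | hX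
  · simp [Real.iSup_of_isEmpty]
  · exact ciSup_mono (hN.bddAbove t ht j) fun x => hN.monotone j x hs ht hst

theorem NonDecreasing.alpha_zero_le (hN : S.NonDecreasing c₀) (ht : 0 ≤ t) :
    S.alpha 0 ≤ S.alpha t := hN.alpha_mono self_mem_Ici ht ht

theorem NonDecreasing.alpha_pos (hN : S.NonDecreasing c₀) (ht : 0 ≤ t) : 0 < S.alpha t :=
  hN.alpha_zero_pos.trans_le (hN.alpha_zero_le ht)

theorem real_univ_le_muMax (S : DampedSystem H V X) (j : Fin J) :
    (S.μ j).real univ ≤ S.muMax :=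
  le_ciSup (f := fun j => (S.μ j).real univ) (finite_range _).bddAbove j

theorem muMin_le_real_univ (S : DampedSystem H V X) (j : Fin J) :
    S.muMin ≤ (S.μ j).real univ :=
  ciInf_le (f := fun j => (S.μ j).real univ) (finite_range _).bddBelow j

theorem muMin_nonneg (S : DampedSystem H V X) : 0 ≤ S.muMin :=
  Real.iInf_nonneg fun _ => measureReal_nonneg

/-- The `j`-th component of `I_U v` as a function on `X_j`. -/
abbrev ctrl (S : DampedSystem H V X) (v : V) (j : Fin J) :
    X j → EuclideanSpace ℝ (Fin (S.N j)) :=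
  ((S.IU v j : Lp (EuclideanSpace ℝ (Fin (S.N j))) 2 (S.μ j)) : X j → _)

theorem memLp_ctrl (S : DampedSystem H V X) (v : V) (j : Fin J) :
    MemLp (S.ctrl v j) 2 (S.μ j) := Lp.memLp _

theorem inner_IU (S : DampedSystem H V X) (v w : V) :
    inner ℝ (S.IU v) (S.IU w) = ∑ j, ∫ x, inner ℝ (S.ctrl v j x) (S.ctrl w j x) ∂(S.μ j) := by
  rw [PiLp.inner_apply]
  refine Finset.sum_congr rfl fun j _ => ?_
  rw [Submodule.coe_inner, L2.inner_def]

theorem Standing.inner_g_nonneg (hS : S.Standing M) (j : Fin J)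
    (x : EuclideanSpace ℝ (Fin (S.N j))) : 0 ≤ inner ℝ (S.g j x) x := by
  simpa [hS.g_zero j] using hS.g_monotone j x 0

theorem Standing.continuous_α (hS : S.Standing M) (ht : 0 ≤ t) (j : Fin J) :
    Continuous (S.α j t) :=
  (hS.α_continuous j).comp_continuous (f := fun x => (t, x)) (by fun_prop) fun x => ⟨ht, mem_univ x⟩

theorem Standing.memLp_g (hS : S.Standing M) (v : V) (j : Fin J) :
    MemLp (fun x => S.g j (S.ctrl v j x)) 2 (S.μ j) := by
  have := hS.finite j
  have h1 : MemLp (fun x => M * (1 + ‖S.ctrl v j x‖)) 2 (S.μ j) :=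
    ((memLp_const (1 : ℝ)).add (S.memLp_ctrl v j).norm).const_mul M
  refine h1.mono' ?_ (Eventually.of_forall fun x => hS.g_growth j _)
  exact (hS.g_continuous j).comp_aestronglyMeasurable (S.memLp_ctrl v j).1

theorem B_eq (S : DampedSystem H V X) (t : ℝ) (v w : V) :
    S.B t v w =
      ∑ j, ∫ x, inner ℝ (S.α j t x • S.g j (S.ctrl v j x)) (S.ctrl w j x) ∂(S.μ j) := by
  simp only [B, real_inner_smul_left]

theorem Standing.feedback_inner_nonneg (hS : S.Standing M) (ht : 0 ≤ t) (v : V) (j : Fin J)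
    (x : X j) : 0 ≤ inner ℝ (S.α j t x • S.g j (S.ctrl v j x)) (S.ctrl v j x) := by
  rw [real_inner_smul_left]
  exact mul_nonneg (hS.α_pos j t x ht).le (hS.inner_g_nonneg j _)

theorem Standing.B_self_nonneg (hS : S.Standing M) (ht : 0 ≤ t) (v : V) : 0 ≤ S.B t v v := by
  rw [B_eq]
  exact Finset.sum_nonneg fun j _ => integral_nonneg fun x => hS.feedback_inner_nonneg ht v j x

variable [∀ j, OpensMeasurableSpace (X j)]

theorem Standing.memLp_feedback (hS : S.Standing M) (hN : S.NonDecreasing c₀) (ht : 0 ≤ t)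
    (v : V) (j : Fin J) :
    MemLp (fun x => S.α j t x • S.g j (S.ctrl v j x)) 2 (S.μ j) := by
  refine (hS.memLp_g v j).of_le_mul (c := S.alpha t) ?_ (Eventually.of_forall fun x => ?_)
  · exact (hS.continuous_α ht j).aestronglyMeasurable.smul (hS.memLp_g v j).1
  · rw [norm_smul, Real.norm_of_nonneg (hS.α_pos j t x ht).le]
    gcongr
    exact (hN.comparable t ht j x).2

theorem Standing.integrable_feedback_inner (hS : S.Standing M) (hN : S.NonDecreasing c₀)
    (ht : 0 ≤ t) (v w : V) (j : Fin J) :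
    Integrable (fun x => inner ℝ (S.α j t x • S.g j (S.ctrl v j x)) (S.ctrl w j x)) (S.μ j) :=
  integrable_inner_of_memLp (hS.memLp_feedback hN ht v j) (S.memLp_ctrl w j)

/-- The form `B` carries the weight `α_j ≥ c₀ α(t)`. The division gains the factor `α(t)⁻¹` that
later lowers `α^δ` to `α^(δ - 1)`. -/
theorem Standing.integral_inner_g_le (hS : S.Standing M) (hN : S.NonDecreasing c₀)
    (hc₀ : 0 < c₀) (ht : 0 ≤ t) (v : V) (j : Fin J) :
    ∫ x, inner ℝ (S.g j (S.ctrl v j x)) (S.ctrl v j x) ∂(S.μ j) ≤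
      S.B t v v / (c₀ * S.alpha t) := by
  have ha := hN.alpha_pos ht
  rw [le_div_iff₀ (by positivity), mul_comm, ← integral_const_mul, B_eq]
  refine le_trans ?_ (Finset.single_le_sum
    (f := fun j => ∫ x, inner ℝ (S.α j t x • S.g j (S.ctrl v j x)) (S.ctrl v j x) ∂(S.μ j))
    (fun j _ => integral_nonneg fun x => hS.feedback_inner_nonneg ht v j x) (Finset.mem_univ j))
  refine integral_mono ((integrable_inner_of_memLp (hS.memLp_g v j) (S.memLp_ctrl v j)).const_mul _)
    (hS.integrable_feedback_inner hN ht v v j) fun x => ?_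
  simp only [real_inner_smul_left]
  exact mul_le_mul_of_nonneg_right (hN.comparable t ht j x).1 (hS.inner_g_nonneg j _)

/-- The bound of the observation `‖I_U v‖² + ‖α g(I_U v)‖²` on `X_j` by the dissipation. -/
theorem Standing.integral_norm_sq_le (hS : S.Standing M) (hN : S.NonDecreasing c₀)
    (hG : IsGrowthFunction G δ CG) (hg : ∀ j, IsControlledBy (S.g j) m G) (hM : 0 < M)
    (hm : 0 < m) (hδ : 2 ≤ δ) (hCG : 0 < CG) (hc₀ : 0 < c₀) (hμ : 0 < S.muMin)
    (ht : 0 ≤ t) (v : V) (j : Fin J) :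
    ∫ x, (‖S.ctrl v j x‖ ^ 2 + ‖S.α j t x • S.g j (S.ctrl v j x)‖ ^ 2) ∂(S.μ j) ≤
      (1 + (S.alpha 0 ^ 2)⁻¹) * CG * S.muMax * G (S.alpha t ^ (δ - 1) * S.B t v v / (S.muMin * c₀))
      + ((S.alpha 0 ^ 2)⁻¹ + 4 * M ^ 2) / m * S.alpha 0 ^ (2 - δ) * S.muMax *
        (S.alpha t ^ (δ - 1) * S.B t v v / (S.muMin * c₀)) := by
  have := hS.finite j
  have ha₀ := hN.alpha_zero_pos
  have ha := hN.alpha_pos ht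
  have hB := hS.B_self_nonneg ht v
  have hδ0 : 0 < δ := by linarith
  set a := S.alpha t with ha_def
  set f : X j → ℝ := fun x => inner ℝ (S.g j (S.ctrl v j x)) (S.ctrl v j x) with hf
  have hfi : Integrable f (S.μ j) := integrable_inner_of_memLp (hS.memLp_g v j) (S.memLp_ctrl v j)
  have hf0 : ∀ x, 0 ≤ f x := fun x => hS.inner_g_nonneg j _
  have hfI := hS.integral_inner_g_le hN hc₀ ht v j
  have hpow : a ^ δ = a ^ (δ - 1) * a := by
    rw [← Real.rpow_add_one ha.ne', sub_add_cancel]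
  have hI : ∫ x, a ^ δ * f x ∂(S.μ j) ≤ a ^ (δ - 1) * S.B t v v / c₀ := by
    rw [integral_const_mul]
    calc a ^ δ * ∫ x, f x ∂(S.μ j) ≤ a ^ δ * (S.B t v v / (c₀ * a)) := by gcongr
      _ = _ := by rw [hpow]; field_simp
  obtain ⟨hGi, hGI⟩ := hG.integral_comp_le hδ0 (S.μ j) (hfi.const_mul (a ^ δ))
    (Eventually.of_forall fun x => mul_nonneg (by positivity) (hf0 x)) hμ (S.muMin_le_real_univ j) hI
  rw [div_div, mul_comm c₀] at hGI
  have hY : 0 ≤ a ^ (δ - 1) * S.B t v v / (S.muMin * c₀) := by positivity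
  have hGY := hG.nonneg hY
  have hμj : 0 < (S.μ j).real univ := hμ.trans_le (S.muMin_le_real_univ j)
  have hmax : 0 < S.muMax := hμj.trans_le (S.real_univ_le_muMax j)
  have hquad : a ^ 2 * ∫ x, f x ∂(S.μ j) ≤
      S.alpha 0 ^ (2 - δ) * S.muMax * (a ^ (δ - 1) * S.B t v v / (S.muMin * c₀)) := by
    -- The quadratic part only needs `a`, which `a^(δ - 1)` dominates up to a constant because `δ ≥
    -- 2` and `α(t) ≥ α(0)`.
    have h1 : a ^ (2 - δ) ≤ S.alpha 0 ^ (2 - δ) :=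
      Real.rpow_le_rpow_of_nonpos ha₀ (hN.alpha_zero_le ht) (by linarith)
    have h2 : a = a ^ (2 - δ) * a ^ (δ - 1) := by
      rw [← Real.rpow_add ha]
      norm_num
    calc a ^ 2 * ∫ x, f x ∂(S.μ j) ≤ a ^ 2 * (S.B t v v / (c₀ * a)) := by gcongr
      _ = a * (S.B t v v / c₀) := by field_simp
      _ = a ^ (2 - δ) * S.muMin * (a ^ (δ - 1) * S.B t v v / (S.muMin * c₀)) := by
        rw [← mul_div_assoc]
        conv_lhs => rw [h2]
        field_simp
      _ ≤ _ := by
        gcongr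
        exact (S.muMin_le_real_univ j).trans (S.real_univ_le_muMax j)
  calc ∫ x, (‖S.ctrl v j x‖ ^ 2 + ‖S.α j t x • S.g j (S.ctrl v j x)‖ ^ 2) ∂(S.μ j)
      ≤ ∫ x, ((1 + (S.alpha 0 ^ 2)⁻¹) * CG * G (a ^ δ * f x) +
        ((S.alpha 0 ^ 2)⁻¹ + 4 * M ^ 2) / m * (a ^ 2 * f x)) ∂(S.μ j) := by
        refine integral_mono ?_ ((hGi.const_mul _).add ((hfi.const_mul _).const_mul _)) fun x => ?_
        · exact (S.memLp_ctrl v j).integrable_norm_pow (by norm_num) |>.add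
            ((hS.memLp_feedback hN ht v j).integrable_norm_pow (by norm_num))
        · exact (hg j).norm_sq_add_le hG hm hM hCG (hS.g_growth j) (hS.inner_g_nonneg j) ha₀
            (hN.alpha_zero_le ht) (hS.α_pos j t x ht).le (hN.comparable t ht j x).2 _
    _ = (1 + (S.alpha 0 ^ 2)⁻¹) * CG * ∫ x, G (a ^ δ * f x) ∂(S.μ j) +
        ((S.alpha 0 ^ 2)⁻¹ + 4 * M ^ 2) / m * (a ^ 2 * ∫ x, f x ∂(S.μ j)) := by
        rw [integral_add (hGi.const_mul _) ((hfi.const_mul _).const_mul _), integral_const_mul,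
          integral_const_mul, integral_const_mul]
    _ ≤ (1 + (S.alpha 0 ^ 2)⁻¹) * CG *
          (S.muMax * G (a ^ (δ - 1) * S.B t v v / (S.muMin * c₀))) +
        ((S.alpha 0 ^ 2)⁻¹ + 4 * M ^ 2) / m *
          (S.alpha 0 ^ (2 - δ) * S.muMax * (a ^ (δ - 1) * S.B t v v / (S.muMin * c₀))) := by
        gcongr
        exact hGI.trans (mul_le_mul_of_nonneg_right (S.real_univ_le_muMax j) hGY)
    _ = _ := by ring

/-- The constant of the observability estimate. -/
def obsConst (J : ℕ) (μmax a₀ M m δ CG : ℝ) : ℝ :=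
  J * ((1 + (a₀ ^ 2)⁻¹) * CG * μmax + ((a₀ ^ 2)⁻¹ + 4 * M ^ 2) / m * a₀ ^ (2 - δ) * μmax)

theorem Standing.abs_B_add_inner_le (hS : S.Standing M) (hN : S.NonDecreasing c₀)
    (hG : IsGrowthFunction G δ CG) (hg : ∀ j, IsControlledBy (S.g j) m G) (hM : 0 < M)
    (hm : 0 < m) (hδ : 2 ≤ δ) (hCG : 0 < CG) (hc₀ : 0 < c₀) (hμ : 0 < S.muMin)
    (ht : 0 ≤ t) (v w : V) {Y : ℝ} (hY : S.alpha t ^ (δ - 1) * S.B t v v / (S.muMin * c₀) ≤ Y) :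
    |S.B t v w + inner ℝ (S.IU w) (S.IU v)| ≤ 1 / 2 * ‖S.IU w‖ ^ 2 +
      obsConst J S.muMax (S.alpha 0) M m δ CG * (Y + G Y) := by
  have ha₀ := hN.alpha_zero_pos
  have ha := hN.alpha_pos ht
  have hB := hS.B_self_nonneg ht v
  set Y' := S.alpha t ^ (δ - 1) * S.B t v v / (S.muMin * c₀) with hY'
  have hY0 : 0 ≤ Y' := by positivity
  have hGY := hG.nonneg (hY0.trans hY)
  have hGYY := hG.mono hY0 hY
  rw [B_eq, inner_IU, ← real_inner_self_eq_norm_sq, inner_IU, ← Finset.sum_add_distrib,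
    Finset.mul_sum]
  refine (Finset.abs_sum_le_sum_abs _ _).trans ?_
  set k₂ := (1 + (S.alpha 0 ^ 2)⁻¹) * CG * S.muMax with hk₂
  set k₁ := ((S.alpha 0 ^ 2)⁻¹ + 4 * M ^ 2) / m * S.alpha 0 ^ (2 - δ) * S.muMax with hk₁
  have hterm : ∀ j ∈ (Finset.univ : Finset (Fin J)),
      |∫ x, inner ℝ (S.α j t x • S.g j (S.ctrl v j x)) (S.ctrl w j x) ∂(S.μ j) +
        ∫ x, inner ℝ (S.ctrl w j x) (S.ctrl v j x) ∂(S.μ j)| ≤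
      1 / 2 * ∫ x, inner ℝ (S.ctrl w j x) (S.ctrl w j x) ∂(S.μ j) + (k₂ + k₁) * (Y + G Y) := by
    intro j _
    have hmax : 0 ≤ S.muMax := measureReal_nonneg.trans (S.real_univ_le_muMax j)
    have i1 := hS.integrable_feedback_inner hN ht v w j
    have i2 : Integrable (fun x => inner ℝ (S.ctrl w j x) (S.ctrl v j x)) (S.μ j) :=
      integrable_inner_of_memLp (S.memLp_ctrl w j) (S.memLp_ctrl v j)
    have i3 : Integrable (fun x => inner ℝ (S.ctrl w j x) (S.ctrl w j x)) (S.μ j) :=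
      integrable_inner_of_memLp (S.memLp_ctrl w j) (S.memLp_ctrl w j)
    have i4 : Integrable
        (fun x => ‖S.ctrl v j x‖ ^ 2 + ‖S.α j t x • S.g j (S.ctrl v j x)‖ ^ 2) (S.μ j) :=
      (S.memLp_ctrl v j).integrable_norm_pow (by norm_num) |>.add
        ((hS.memLp_feedback hN ht v j).integrable_norm_pow (by norm_num))
    have hmain := hS.integral_norm_sq_le hN hG hg hM hm hδ hCG hc₀ hμ ht v j
    rw [← integral_add i1 i2]
    refine (abs_integral_le_integral_abs).trans ?_
    calc ∫ x, |inner ℝ (S.α j t x • S.g j (S.ctrl v j x)) (S.ctrl w j x) +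
          inner ℝ (S.ctrl w j x) (S.ctrl v j x)| ∂(S.μ j)
        ≤ ∫ x, (1 / 2 * inner ℝ (S.ctrl w j x) (S.ctrl w j x) +
          (‖S.ctrl v j x‖ ^ 2 + ‖S.α j t x • S.g j (S.ctrl v j x)‖ ^ 2)) ∂(S.μ j) := by
          refine integral_mono (i1.add i2).abs ((i3.const_mul _).add i4) fun x => ?_
          simp only
          rw [real_inner_self_eq_norm_sq, real_inner_comm (S.ctrl v j x)]
          generalize S.α j t x • S.g j (S.ctrl v j x) = p
          generalize S.ctrl v j x = u
          generalize S.ctrl w j x = q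
          -- Young's inequality `‖p‖ ‖q‖ ≤ ‖p‖² + ‖q‖² / 4`, used for `p` and for `u`, produces the
          -- coefficient `1 / 2` of `‖q‖²`.
          have h1 := (abs_add_le (inner ℝ p q) (inner ℝ u q)).trans
            (add_le_add (abs_real_inner_le_norm p q) (abs_real_inner_le_norm u q))
          nlinarith [sq_nonneg (‖p‖ - ‖q‖ / 2), sq_nonneg (‖u‖ - ‖q‖ / 2)]
      _ = _ := by rw [integral_add (i3.const_mul _) i4, integral_const_mul]
      _ ≤ _ := by
          gcongr
          refine hmain.trans ?_
          have hk₁0 : 0 ≤ k₁ := by positivity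
          have hk₂0 : 0 ≤ k₂ := by positivity
          nlinarith [mul_le_mul_of_nonneg_left hGYY hk₂0, mul_le_mul_of_nonneg_left hY hk₁0,
            mul_nonneg hk₂0 (hY0.trans hY), mul_nonneg hk₁0 hGY]
  refine (Finset.sum_le_sum hterm).trans (le_of_eq ?_)
  rw [Finset.sum_add_distrib, Finset.sum_const, Finset.card_univ, Fintype.card_fin, nsmul_eq_mul,
    obsConst]
  ring

end DampedSystem

/-! ### Dissipation of energy and observability. -/

theorem energy_nonneg {H : Type*} [NormedAddCommGroup H] (x : ℝ → H) (t : ℝ) : 0 ≤ energy x t := by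
  unfold energy
  positivity

namespace DampedSystem

variable {H V : Type*} [NormedAddCommGroup H] [InnerProductSpace ℝ H]
  [NormedAddCommGroup V] [InnerProductSpace ℝ V]
  {J : ℕ} {X : Fin J → Type*} [∀ j, MetricSpace (X j)] [∀ j, MeasurableSpace (X j)]
  {S : DampedSystem H V X} {M m δ CG c₀ C ω t : ℝ} {G : ℝ → ℝ} {x y : ℝ → H}

theorem Standing.A₁_symm (hS : S.Standing M) (v w : V) : S.A₁ w v = -S.A₁ v w := by
  have h := hS.A₁_skew (v + w)
  simp only [map_add, add_apply, hS.A₁_skew] at h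
  linarith

theorem Standing.inner_nonneg_of_AB (hS : S.Standing M) (ht : 0 ≤ t) {a b : H}
    (h : S.AB t a b) : 0 ≤ inner ℝ b a := by
  obtain ⟨v, rfl, hv⟩ := h
  beta_reduce at hv
  rw [← hv v, hS.A₁_skew, zero_add]
  exact hS.B_self_nonneg ht v

/-- `y` witnesses that `x` is a solution with exceptional set `Z`. -/
def IsSolutionWith (S : DampedSystem H V X) (x y : ℝ → H) (Z : Set ℝ) : Prop :=
  ContinuousOn x (Ici 0) ∧ (∀ t, 0 ≤ t → S.AB t (x t) (y t)) ∧ Z.Countable ∧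
    ∀ t, 0 < t → t ∉ Z → HasDerivAt x (-y t) t

theorem IsSolution.exists_isSolutionWith (hx : S.IsSolution x) :
    ∃ y Z, S.IsSolutionWith x y Z := by
  obtain ⟨hc, y, hy, Z, hZ, hd⟩ := hx
  exact ⟨y, Z, hc, hy, hZ, fun t ht htZ =>
    (hd t ⟨mem_Ici.2 ht.le, htZ⟩).1.hasDerivAt (Ici_mem_nhds ht)⟩

variable {Z : Set ℝ}

theorem IsSolutionWith.hasDerivAt_energy (hx : S.IsSolutionWith x y Z) (ht : 0 < t)
    (htZ : t ∉ Z) : HasDerivAt (energy x) (-inner ℝ (y t) (x t)) t := by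
  have h := ((hx.2.2.2 t ht htZ).norm_sq).div_const 2
  refine h.congr_deriv ?_
  rw [inner_neg_right, real_inner_comm]
  ring

theorem IsSolutionWith.continuousOn_energy (hx : S.IsSolutionWith x y Z) :
    ContinuousOn (energy x) (Ici 0) := (hx.1.norm.pow 2).div_const 2

/-- The derivative is minus the dissipation off a countable set. Its integrability is not yet known,
so the mean value inequality replaces integration. -/
theorem IsSolutionWith.energy_antitoneOn (hS : S.Standing M) (hx : S.IsSolutionWith x y Z) :
    AntitoneOn (energy x) (Ici 0) := by
  intro s hs t ht hst
  have hs0 : 0 ≤ s := hs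
  refine le_of_hasDerivAt_nonpos_off_countable hx.2.2.1 hst
    (hx.continuousOn_energy.mono fun r hr => hs0.trans hr.1)
    (fun r hr => hx.hasDerivAt_energy (hs0.trans_lt hr.1.1) hr.2) fun r hr => ?_
  have hr0 := (hs0.trans_lt hr.1.1).le
  exact neg_nonpos.2 (hS.inner_nonneg_of_AB hr0 (hx.2.1 r hr0))

theorem ae_restrict_Ioc_off_countable (hZ : Z.Countable) (s t : ℝ) {P : ℝ → Prop}
    (h : ∀ r ∈ Ioo s t, r ∉ Z → P r) : ∀ᵐ r ∂volume.restrict (Ioc s t), P r := by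
  rw [ae_restrict_iff' measurableSet_Ioc]
  filter_upwards [(hZ.insert t).ae_notMem volume] with r hr hrm
  rw [mem_insert_iff, not_or] at hr
  exact h r ⟨hrm.1, lt_of_le_of_ne hrm.2 hr.1⟩ hr.2

/-- Lebesgue's theorem for monotone functions: the a.e. derivative of `-E` is integrable, and its
integral is at most the increment. -/
theorem IsSolutionWith.integrable_dissipation (hS : S.Standing M) (hx : S.IsSolutionWith x y Z)
    {s T : ℝ} (hs : 0 ≤ s) (hT : 0 < T) :
    Integrable (fun r => inner ℝ (y r) (x r)) (volume.restrict (Ioc s (s + T))) ∧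
    ∫ r, inner ℝ (y r) (x r) ∂(volume.restrict (Ioc s (s + T))) ≤
      energy x s - energy x (s + T) := by
  have hle : s ≤ s + T := by linarith
  have hmono : MonotoneOn (fun r => -energy x r) (uIcc s (s + T)) := by
    rw [uIcc_of_le hle]
    exact ((hx.energy_antitoneOn hS).mono fun r hr => hs.trans hr.1).neg
  have hi := hmono.intervalIntegrable_deriv
  have hb := hmono.intervalIntegral_deriv_mem_uIcc
  rw [intervalIntegrable_iff_integrableOn_Ioc_of_le hle] at hi
  rw [intervalIntegral.integral_of_le hle] at hb
  have hae : ∀ᵐ r ∂volume.restrict (Ioc s (s + T)),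
      deriv (fun r => -energy x r) r = inner ℝ (y r) (x r) :=
    ae_restrict_Ioc_off_countable hx.2.2.1 _ _ fun r hr hrZ => by
      rw [(hx.hasDerivAt_energy (hs.trans_lt hr.1) hrZ).fun_neg.deriv, neg_neg]
  refine ⟨hi.congr hae, ?_⟩
  rw [integral_congr_ae hae] at hb
  have h0 : energy x (s + T) ≤ energy x s := hx.energy_antitoneOn hS hs (hs.trans hle) hle
  rw [uIcc_of_le (by linarith)] at hb
  linarith [hb.2]

set_option synthInstance.maxHeartbeats 100000 in
/-- The observability estimate tested against a trajectory of the semigroup generated by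
`-A₁ - I_U`. -/
theorem IsSolutionWith.inner_le {R : ℝ → H →L[ℝ] H} (hS : S.Standing M)
    (hR : IsContractionSemigroup R) (hgen : IsGenerator S.AMinus R)
    (hx : S.IsSolutionWith x y Z) {s T : ℝ} (hs : 0 ≤ s) (hT : 0 < T)
    {Q : ℝ → ℝ} (hQ : Integrable Q (volume.restrict (Ioc s (s + T))))
    (hbound : ∀ r ∈ Ioo s (s + T), ∀ v w : V, S.ι v = x r →
      B S r v v = inner ℝ (y r) (x r) →
      |S.B r v w + inner ℝ (S.IU w) (S.IU v)| ≤ 1 / 2 * ‖S.IU w‖ ^ 2 + Q r)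
    {z₀ y₀ : H} (hz : S.AMinus z₀ y₀) :
    inner ℝ (x s) z₀ ≤ inner ℝ (x (s + T)) (R T z₀) + 1 / 4 * ‖z₀‖ ^ 2 +
      ∫ r, Q r ∂(volume.restrict (Ioc s (s + T))) := by
  have hle : s ≤ s + T := by linarith
  set z : ℝ → H := fun r => R (r - s) z₀ with hzdef
  set yz : ℝ → H := fun r => R (r - s) y₀ with hyzdef
  have hsub : MapsTo (fun r => r - s) (Icc s (s + T)) (Ici 0) := fun r hr => sub_nonneg.2 hr.1
  have hzc : ContinuousOn z (Icc s (s + T)) := (hR.continuousOn z₀).comp (by fun_prop) hsub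
  have hyzc : ContinuousOn yz (Icc s (s + T)) := (hR.continuousOn y₀).comp (by fun_prop) hsub
  have hzd : ∀ r ∈ Ioo s (s + T), HasDerivAt z (yz r) r := fun r hr =>
    (hgen.hasDerivAt hR hz (sub_pos.2 hr.1)).comp_sub_const r s
  have hz0 : z s = z₀ := by simp [hzdef, hR.zero_apply]
  have hzT : z (s + T) = R T z₀ := by simp [hzdef]
  -- the energy identity for `z`
  have hN : IntervalIntegrable (fun r => -inner ℝ (yz r) (z r)) volume s (s + T) := by
    refine ContinuousOn.intervalIntegrable ?_
    rw [uIcc_of_le hle]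
    exact (hyzc.inner hzc).neg
  have hNint : ∫ r in s..(s + T), -inner ℝ (yz r) (z r) ≤ 1 / 2 * ‖z₀‖ ^ 2 := by
    have h := integral_eq_of_hasDerivAt_off_countable_of_le (fun r => -(‖z r‖ ^ 2 / 2))
      (fun r => -inner ℝ (yz r) (z r)) hle countable_empty ((hzc.norm.pow 2).div_const 2).neg
      (fun r hr => by
        refine (((hzd r hr.1).norm_sq).div_const 2).fun_neg.congr_deriv ?_
        rw [real_inner_comm]
        ring) hN
    rw [h, hz0]
    nlinarith [sq_nonneg ‖z (s + T)‖]
  -- the pairing of `x` with `z`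
  set φ' : ℝ → ℝ := fun r => inner ℝ (x r) (yz r) + inner ℝ (-y r) (z r) with hφ'
  have hφc : ContinuousOn (fun r => inner ℝ (x r) (z r)) (Icc s (s + T)) :=
    (hx.1.mono fun r hr => hs.trans hr.1).inner hzc
  have hφd : ∀ r ∈ Ioo s (s + T) \ Z, HasDerivAt (fun r => inner ℝ (x r) (z r)) (φ' r) r :=
    fun r hr => (hx.2.2.2 r (hs.trans_lt hr.1.1) hr.2).inner ℝ (hzd r hr.1)
  have hφb : ∀ r ∈ Ioo s (s + T), |φ' r| ≤ 1 / 2 * -inner ℝ (yz r) (z r) + Q r := by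
    intro r hr
    have hr0 : 0 ≤ r := hs.trans hr.1.le
    obtain ⟨v, hv, hvy⟩ := hx.2.1 r hr0
    obtain ⟨w, hw, hwy⟩ := hgen.apply hR hz (sub_nonneg.2 hr.1.le)
    beta_reduce at hvy hwy
    -- The equation for `x` is tested with `w` and that for `z` with `v`; by antisymmetry the two
    -- `A₁` terms cancel.
    have e1 : φ' r = -(S.B r v w + inner ℝ (S.IU w) (S.IU v)) := by
      have h1 := hvy w
      have h2 := hwy v
      rw [hw] at h1
      rw [hv, hS.A₁_symm v w] at h2
      simp only [hφ']
      rw [real_inner_comm, inner_neg_left]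
      simp only [hzdef, hyzdef]
      linarith
    have e2 : -inner ℝ (yz r) (z r) = ‖S.IU w‖ ^ 2 := by
      have h2 := hwy w
      have h4 : inner ℝ (S.IU w) (S.IU w) = ‖S.IU w‖ ^ 2 := real_inner_self_eq_norm_sq _
      rw [hw, hS.A₁_skew, h4] at h2
      simp only [hzdef, hyzdef]
      linarith
    rw [e1, abs_neg, e2]
    refine hbound r hr v w hv ?_
    have h3 := hvy v
    rwa [hS.A₁_skew, zero_add, hv] at h3
  rw [intervalIntegrable_iff_integrableOn_Ioc_of_le hle] at hN
  have hbi : Integrable (fun r => 1 / 2 * -inner ℝ (yz r) (z r) + Q r)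
      (volume.restrict (Ioc s (s + T))) := (Integrable.const_mul hN _).add hQ
  have hφbae : ∀ᵐ r ∂volume.restrict (Ioc s (s + T)),
      ‖φ' r‖ ≤ 1 / 2 * -inner ℝ (yz r) (z r) + Q r :=
    ae_restrict_Ioc_off_countable countable_empty _ _ fun r hr _ => hφb r hr
  -- Measurability comes for free, since `φ'` is a.e. a derivative; the bound just proved then gives
  -- integrability.
  have hφi : Integrable φ' (volume.restrict (Ioc s (s + T))) := by
    refine hbi.mono' ?_ hφbae
    refine ((measurable_deriv fun r => (inner ℝ (x r) (z r) : ℝ)).aestronglyMeasurable).congr ?_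
    exact ae_restrict_Ioc_off_countable hx.2.2.1 _ _ fun r hr hrZ => (hφd r ⟨hr, hrZ⟩).deriv
  have hftc := integral_eq_of_hasDerivAt_off_countable_of_le _ _ hle hx.2.2.1 hφc hφd
    ((intervalIntegrable_iff_integrableOn_Ioc_of_le hle).2 hφi)
  have hfin : -∫ r in s..(s + T), φ' r ≤
      1 / 2 * (∫ r in s..(s + T), -inner ℝ (yz r) (z r)) +
        ∫ r, Q r ∂(volume.restrict (Ioc s (s + T))) := by
    rw [intervalIntegral.integral_of_le hle, intervalIntegral.integral_of_le hle,
      ← integral_const_mul, ← integral_add (Integrable.const_mul hN _) hQ, ← integral_neg]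
    refine integral_mono_ae hφi.neg hbi ?_
    filter_upwards [hφbae] with r hr
    exact (neg_le_abs _).trans hr
  simp only [hz0, hzT] at hftc
  linarith

variable [CompleteSpace H]

/-- The inequality of `inner_le` is closed in `z₀`, so by density it may be used at `z₀ = x s`. The
decay `1 / 4` and the Young term `1 / 4` absorb half of `‖x s‖²`, and what remains is exactly
`E(s)`. -/
theorem IsSolutionWith.observability {R : ℝ → H →L[ℝ] H} (hS : S.Standing M)
    (hR : IsContractionSemigroup R) (hgen : IsGenerator S.AMinus R)
    (hx : S.IsSolutionWith x y Z) {s T : ℝ} (hs : 0 ≤ s) (hT : 0 < T)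
    (hdecay : ∀ z, ‖R T z‖ ≤ 1 / 4 * ‖z‖)
    {Q : ℝ → ℝ} (hQ : Integrable Q (volume.restrict (Ioc s (s + T))))
    (hbound : ∀ r ∈ Ioo s (s + T), ∀ v w : V, S.ι v = x r →
      B S r v v = inner ℝ (y r) (x r) →
      |S.B r v w + inner ℝ (S.IU w) (S.IU v)| ≤ 1 / 2 * ‖S.IU w‖ ^ 2 + Q r) :
    energy x s ≤ ∫ r, Q r ∂(volume.restrict (Ioc s (s + T))) := by
  set I := ∫ r, Q r ∂(volume.restrict (Ioc s (s + T)))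
  have hnorm : ‖x (s + T)‖ ≤ ‖x s‖ := by
    have h := hx.energy_antitoneOn hS hs (show (0 : ℝ) ≤ s + T by linarith) (by linarith)
    unfold energy at h
    exact (abs_le_of_sq_le_sq' (by linarith) (norm_nonneg _)).2
  have hcl : IsClosed {z : H | inner ℝ (x s) z ≤ 1 / 4 * (‖x s‖ * ‖z‖) + 1 / 4 * ‖z‖ ^ 2 + I} :=
    isClosed_le (by fun_prop) (by fun_prop)
  have hD : {z | ∃ b, S.AMinus z b} ⊆
      {z : H | inner ℝ (x s) z ≤ 1 / 4 * (‖x s‖ * ‖z‖) + 1 / 4 * ‖z‖ ^ 2 + I} := by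
    rintro z ⟨b, hz⟩
    have h1 := hx.inner_le hS hR hgen hs hT hQ hbound hz
    have h2 : inner ℝ (x (s + T)) (R T z) ≤ ‖x s‖ * (1 / 4 * ‖z‖) :=
      (real_inner_le_norm _ _).trans (mul_le_mul hnorm (hdecay z) (norm_nonneg _) (norm_nonneg _))
    simp only [mem_ofPred_eq]
    linarith
  have h := hcl.closure_subset_iff.2 hD ((hgen.dense hR) (x s))
  simp only [mem_ofPred_eq, real_inner_self_eq_norm_sq] at h
  unfold energy
  nlinarith

variable [∀ j, OpensMeasurableSpace (X j)]

/-- The dissipation over a time window of length `T` controls the energy at its beginning. -/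
theorem IsSolutionWith.energy_le (hS : S.Standing M) (hN : S.NonDecreasing c₀)
    (hG : IsGrowthFunction G δ CG) (hg : ∀ j, IsControlledBy (S.g j) m G) (hM : 0 < M)
    (hm : 0 < m) (hδ : 2 ≤ δ) (hCG : 0 < CG) (hc₀ : 0 < c₀) (hμ : 0 < S.muMin)
    (hgen : S.StableGeneration C ω) (hx : S.IsSolutionWith x y Z) {s T : ℝ} (hs : 0 ≤ s)
    (hT : 0 < T) (hCT : C * Real.exp (-ω * T) ≤ 1 / 4) {Y : ℝ}
    (hY : Y = S.alpha (s + T) ^ (δ - 1) * (energy x s - energy x (s + T)) /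
      (T * S.muMin * c₀)) :
    energy x s ≤ obsConst J S.muMax (S.alpha 0) M m δ CG * T * (Y + G Y) := by
  obtain ⟨R, hR, hRgen, hRdecay⟩ := hgen.2
  have hδ0 : 0 < δ := by linarith
  have ha := hN.alpha_pos (show (0 : ℝ) ≤ s + T by linarith)
  set A := S.alpha (s + T) ^ (δ - 1) with hA
  set K := obsConst J S.muMax (S.alpha 0) M m δ CG with hK
  obtain ⟨hFi, hFI⟩ := hx.integrable_dissipation hS hs hT
  set F : ℝ → ℝ := fun r => inner ℝ (y r) (x r) with hF
  have hF0 : ∀ r, 0 ≤ r → 0 ≤ F r := fun r hr => hS.inner_nonneg_of_AB hr (hx.2.1 r hr)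
  -- The coefficient is frozen at the right end of the window, where `α^(δ - 1)` is largest; Jensen
  -- in time then sees a constant multiple of the dissipation.
  set k := A / (S.muMin * c₀) with hk
  have hk0 : 0 < k := by positivity
  have hvol : (volume.restrict (Ioc s (s + T))).real univ = T := by simp [hT.le]
  have hI : ∫ r, k * F r ∂(volume.restrict (Ioc s (s + T))) ≤ T * Y := by
    rw [integral_const_mul]
    calc k * ∫ r, F r ∂(volume.restrict (Ioc s (s + T)))
        ≤ k * (energy x s - energy x (s + T)) := by gcongr
      _ = T * Y := by rw [hY, hk]; field_simp
  obtain ⟨hGi, hGI⟩ := hG.integral_comp_le hδ0 (volume.restrict (Ioc s (s + T)))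
    (hFi.const_mul k) (ae_restrict_Ioc_off_countable countable_empty _ _ fun r hr _ =>
      mul_nonneg hk0.le (hF0 r (hs.trans hr.1.le))) hT hvol.ge hI
  rw [hvol, mul_div_cancel_left₀ _ hT.ne'] at hGI
  have hK0 : 0 ≤ K := by
    have hμm : 0 ≤ S.muMax := Real.iSup_nonneg fun _ => measureReal_nonneg
    have := hN.alpha_zero_pos
    rw [hK, obsConst]
    positivity
  refine (hx.observability hS hR hRgen hs hT (fun z => ?_)
    (Q := fun r => K * (k * F r + G (k * F r)))
    (((hFi.const_mul k).add hGi).const_mul K) ?_).trans ?_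
  · exact (hRdecay T hT.le z).trans (by gcongr)
  · intro r hr v w hv hB
    have hr0 : 0 ≤ r := hs.trans hr.1.le
    refine hS.abs_B_add_inner_le hN hG hg hM hm hδ hCG hc₀ hμ hr0 v w ?_
    rw [hB, hk, div_mul_eq_mul_div]
    have h1 : S.alpha r ^ (δ - 1) ≤ A :=
      Real.rpow_le_rpow (hN.alpha_pos hr0).le
        (hN.alpha_mono hr0 (show (0 : ℝ) ≤ s + T by linarith) hr.2.le) (by linarith)
    have := hF0 r hr0
    gcongr
  · rw [integral_const_mul, integral_add (hFi.const_mul k) hGi, mul_assoc]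
    refine mul_le_mul_of_nonneg_left ?_ hK0
    linarith

end DampedSystem

/-! ### The rate integral and summation over periods. -/

namespace DampedSystem

variable {H V : Type*} [NormedAddCommGroup H] [InnerProductSpace ℝ H]
  [NormedAddCommGroup V] [InnerProductSpace ℝ V]
  {J : ℕ} {X : Fin J → Type*} [∀ j, MetricSpace (X j)] [∀ j, MeasurableSpace (X j)]
  {S : DampedSystem H V X} {M m δ CG c c₀ C ω T t : ℝ} {G : ℝ → ℝ} {x y : ℝ → H} {Z : Set ℝ}

/-- The integrand `α(s - T) α(s)^{-δ}` of the decay rate. -/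
def rate (S : DampedSystem H V X) (T δ s : ℝ) : ℝ := S.alpha (s - T) * S.alpha s ^ (-δ)

theorem NonDecreasing.rate_nonneg (hN : S.NonDecreasing c₀) (hT : 0 ≤ T) {s : ℝ} (hs : T ≤ s) :
    0 ≤ S.rate T δ s := by
  have h1 := hN.alpha_pos (sub_nonneg.2 hs)
  have h2 := hN.alpha_pos (hT.trans hs)
  unfold rate
  positivity

/-- The shift by `T` gives `α(s - T) ≤ α(s)`, and `α^(1 - δ)` is non-increasing. -/
theorem NonDecreasing.rate_le (hN : S.NonDecreasing c₀) (hT : 0 ≤ T) (hδ : 1 ≤ δ) {r s : ℝ}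
    (hr : T ≤ r) (hrs : r ≤ s) : S.rate T δ s ≤ S.alpha r ^ (1 - δ) := by
  have hs : T ≤ s := hr.trans hrs
  have h1 := hN.alpha_pos (sub_nonneg.2 hs)
  have h2 := hN.alpha_pos (hT.trans hs)
  have h3 := hN.alpha_pos (hT.trans hr)
  calc S.rate T δ s ≤ S.alpha s * S.alpha s ^ (-δ) := by
        unfold rate
        gcongr
        exact hN.alpha_mono (mem_Ici.2 (sub_nonneg.2 hs)) (mem_Ici.2 (hT.trans hs)) (by linarith)
    _ = S.alpha s ^ (1 - δ) := by
        rw [sub_eq_add_neg, Real.rpow_add h2, Real.rpow_one]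
    _ ≤ S.alpha r ^ (1 - δ) := Real.rpow_le_rpow_of_nonpos h3
        (hN.alpha_mono (mem_Ici.2 (hT.trans hr)) (mem_Ici.2 (hT.trans hs)) hrs) (by linarith)

theorem NonDecreasing.intervalIntegrable_rate (hN : S.NonDecreasing c₀) (hT : 0 ≤ T)
    (hδ : 1 ≤ δ) {a b : ℝ} (ha : T ≤ a) (hb : T ≤ b) :
    IntervalIntegrable (S.rate T δ) volume a b := by
  have hsub : ∀ s ∈ uIcc a b, T ≤ s := fun s hs => (le_min ha hb).trans hs.1
  have h1 : IntervalIntegrable (fun s => S.alpha (s - T)) volume a b := by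
    refine MonotoneOn.intervalIntegrable fun r hr s hs hrs => ?_
    exact hN.alpha_mono (mem_Ici.2 (sub_nonneg.2 (hsub r hr)))
      (mem_Ici.2 (sub_nonneg.2 (hsub s hs))) (by linarith)
  have h2 : IntervalIntegrable (fun s => S.alpha s ^ (-δ)) volume a b := by
    refine AntitoneOn.intervalIntegrable fun r hr s hs hrs => ?_
    exact Real.rpow_le_rpow_of_nonpos (hN.alpha_pos (hT.trans (hsub r hr)))
      (hN.alpha_mono (hT.trans (hsub r hr)) (hT.trans (hsub s hs)) hrs) (by linarith)
  rw [intervalIntegrable_iff] at h1 h2 ⊢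
  have : IsFiniteMeasure (volume.restrict (uIoc a b)) := ⟨by simp [uIoc]⟩
  refine Integrable.mono' (integrable_const (S.alpha T ^ (1 - δ))) (h1.1.mul h2.1) ?_
  rw [ae_restrict_iff' measurableSet_uIoc]
  refine Eventually.of_forall fun s hs => ?_
  have hs := hsub s (uIoc_subset_uIcc hs)
  rw [Real.norm_of_nonneg (hN.rate_nonneg hT hs)]
  exact hN.rate_le hT hδ le_rfl hs

theorem NonDecreasing.integral_rate_nonneg (hN : S.NonDecreasing c₀) (hT : 0 ≤ T) {a b : ℝ}
    (ha : T ≤ a) (hab : a ≤ b) : 0 ≤ ∫ s in a..b, S.rate T δ s :=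
  intervalIntegral.integral_nonneg hab fun _ hs => hN.rate_nonneg hT (ha.trans hs.1)

variable [∀ j, OpensMeasurableSpace (X j)] [CompleteSpace H]

/-- The energy inequality over one period, in terms of `p`. -/
theorem IsSolutionWith.pFun_energy_le (hS : S.Standing M) (hN : S.NonDecreasing c₀)
    (hG : IsGrowthFunction G δ CG) (hg : ∀ j, IsControlledBy (S.g j) m G) (hM : 0 < M)
    (hm : 0 < m) (hδ : 2 ≤ δ) (hCG : 0 < CG) (hc₀ : 0 < c₀) (hμ : 0 < S.muMin)
    (hgen : S.StableGeneration C ω) (hx : S.IsSolutionWith x y Z) {s : ℝ} (hs : 0 ≤ s)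
    (hT : 1 ≤ T) (hCT : C * Real.exp (-ω * T) ≤ 1 / 4) (hc0 : 0 < c)
    (hc : obsConst J S.muMax (S.alpha 0) M m δ CG * T ^ 2 ≤ c) :
    pFun c G (energy x s) * (T ^ 2 * S.muMin * c₀) * S.alpha (s + T) ^ (1 - δ) ≤
      energy x s - energy x (s + T) := by
  have hT0 : 0 < T := by linarith
  have hδ0 : 0 < δ := by linarith
  have ha := hN.alpha_pos (show (0 : ℝ) ≤ s + T by linarith)
  have hE : 0 ≤ energy x s - energy x (s + T) :=
    sub_nonneg.2 (hx.energy_antitoneOn hS hs (show (0 : ℝ) ≤ s + T by linarith) (by linarith))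
  -- This is `1 / T` times the argument in `energy_le`. As `T ≥ 1`, `G(T Y) ≤ T G(Y)`, which
  -- accounts for `T²` in the condition on `c`.
  set Y := S.alpha (s + T) ^ (δ - 1) * (energy x s - energy x (s + T)) /
    (T ^ 2 * S.muMin * c₀) with hY
  have hY0 : 0 ≤ Y := by positivity
  have h := hx.energy_le hS hN hG hg hM hm hδ hCG hc₀ hμ hgen hs hT0 hCT (Y := T * Y)
    (by rw [hY]; field_simp)
  have hμm : 0 ≤ S.muMax := Real.iSup_nonneg fun _ => measureReal_nonneg
  have hK0 : 0 ≤ obsConst J S.muMax (S.alpha 0) M m δ CG := by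
    have := hN.alpha_zero_pos
    rw [obsConst]
    positivity
  have hGY := hG.nonneg hY0
  have h1 : energy x s ≤ hFun c G Y := by
    calc energy x s ≤ obsConst J S.muMax (S.alpha 0) M m δ CG * T * (T * Y + G (T * Y)) := h
      _ ≤ obsConst J S.muMax (S.alpha 0) M m δ CG * T * (T * Y + T * G Y) := by
          gcongr
          exact hG.map_mul_le hT hY0
      _ = obsConst J S.muMax (S.alpha 0) M m δ CG * T ^ 2 * (Y + G Y) := by ring
      _ ≤ hFun c G Y := by
          unfold hFun
          gcongr
  rw [← pFun_le_iff hG hδ0 hc0 (energy_nonneg x s) hY0] at h1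
  have hk : 0 < T ^ 2 * S.muMin * c₀ := by positivity
  have e : S.alpha (s + T) ^ (δ - 1) * S.alpha (s + T) ^ (1 - δ) = 1 := by
    rw [← Real.rpow_add ha]
    simp
  calc pFun c G (energy x s) * (T ^ 2 * S.muMin * c₀) * S.alpha (s + T) ^ (1 - δ)
      ≤ Y * (T ^ 2 * S.muMin * c₀) * S.alpha (s + T) ^ (1 - δ) := by gcongr
    _ = (energy x s - energy x (s + T)) *
        (S.alpha (s + T) ^ (δ - 1) * S.alpha (s + T) ^ (1 - δ)) := by rw [hY]; field_simp
    _ = _ := by rw [e, mul_one]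

/-- The energy drop over `[nT, (n + 1)T]` pays for the rate integral over the next window, where the
rate is at most `α((n + 1)T)^(1 - δ)`. Hence the integral runs one period past the time of the
energy, and `n = 0` is trivial. -/
theorem IsSolutionWith.rate_le_psi_nat (hS : S.Standing M) (hN : S.NonDecreasing c₀)
    (hG : IsGrowthFunction G δ CG) (hg : ∀ j, IsControlledBy (S.g j) m G) (hM : 0 < M)
    (hm : 0 < m) (hδ : 2 ≤ δ) (hCG : 0 < CG) (hc₀ : 0 < c₀) (hμ : 0 < S.muMin)
    (hgen : S.StableGeneration C ω) (hx : S.IsSolutionWith x y Z)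
    (hT : 1 ≤ T) (hCT : C * Real.exp (-ω * T) ≤ 1 / 4) (hc0 : 0 < c)
    (hc : obsConst J S.muMax (S.alpha 0) M m δ CG * T ^ 2 ≤ c) (n : ℕ)
    (hn : 0 < energy x (n * T)) :
    T * S.muMin * c₀ * ∫ s in T..((n + 1 : ℕ) * T), S.rate T δ s ≤
      psi c G (energy x 0) (energy x (n * T)) := by
  have hT0 : 0 < T := by linarith
  have hδ0 : 0 < δ := by linarith
  induction n with
  | zero => simp [psi_self]
  | succ n ih =>
    have hnT : 0 ≤ n * T := by positivity
    have e1 : ((n + 1 : ℕ) : ℝ) * T = n * T + T := by push_cast; ring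
    have hanti := hx.energy_antitoneOn hS
    have hle : energy x ((n + 1 : ℕ) * T) ≤ energy x (n * T) :=
      hanti (mem_Ici.2 hnT) (mem_Ici.2 (by positivity)) (by rw [e1]; linarith)
    have hn' := hn.trans_le hle
    have hE0 : 0 < energy x 0 := hn'.trans_le (hanti self_mem_Ici (mem_Ici.2 hnT) hnT)
    have hstep := hx.pFun_energy_le hS hN hG hg hM hm hδ hCG hc₀ hμ hgen hnT hT hCT hc0 hc
    have hpsi := div_pFun_le_psi_sub_psi hG hδ0 hc0 hn hle hE0
    have hp := pFun_pos hG hδ0 hc0 hn'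
    rw [← e1] at hstep
    have h1 : T ^ 2 * S.muMin * c₀ * S.alpha ((n + 1 : ℕ) * T) ^ (1 - δ) ≤
        psi c G (energy x 0) (energy x ((n + 1 : ℕ) * T)) -
          psi c G (energy x 0) (energy x (n * T)) := by
      refine le_trans ?_ hpsi
      rw [le_div_iff₀ hp]
      linarith
    have hTn : T ≤ (n + 1 : ℕ) * T := by rw [e1]; linarith
    have e2 : ((n + 1 + 1 : ℕ) : ℝ) * T = (n + 1 : ℕ) * T + T := by push_cast; ring
    have hTn2 : T ≤ (n + 1 + 1 : ℕ) * T := by rw [e2]; linarith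
    have i1 := hN.intervalIntegrable_rate hT0.le (by linarith : 1 ≤ δ) le_rfl hTn
    have i2 := hN.intervalIntegrable_rate hT0.le (by linarith : 1 ≤ δ) hTn hTn2
    have h2 : ∫ s in ((n + 1 : ℕ) * T)..((n + 1 + 1 : ℕ) * T), S.rate T δ s ≤
        T * S.alpha ((n + 1 : ℕ) * T) ^ (1 - δ) := by
      have h3 := intervalIntegral.integral_mono_on (by rw [e2]; linarith) i2
        intervalIntegrable_const (g := fun _ => S.alpha ((n + 1 : ℕ) * T) ^ (1 - δ))
        fun s hs => hN.rate_le hT0.le (by linarith) hTn hs.1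
      rwa [intervalIntegral.integral_const, smul_eq_mul, e2, add_sub_cancel_left, ← e2] at h3
    rw [← intervalIntegral.integral_add_adjacent_intervals i1 i2, mul_add]
    have h4 := ih hn'
    have hk : 0 ≤ T * S.muMin * c₀ := by positivity
    have h5 := mul_le_mul_of_nonneg_left h2 hk
    nlinarith

theorem IsSolutionWith.rate_le_psi (hS : S.Standing M) (hN : S.NonDecreasing c₀)
    (hG : IsGrowthFunction G δ CG) (hg : ∀ j, IsControlledBy (S.g j) m G) (hM : 0 < M)
    (hm : 0 < m) (hδ : 2 ≤ δ) (hCG : 0 < CG) (hc₀ : 0 < c₀)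
    (hgen : S.StableGeneration C ω) (hx : S.IsSolutionWith x y Z)
    (hT : 1 ≤ T) (hCT : C * Real.exp (-ω * T) ≤ 1 / 4) (hc0 : 0 < c)
    (hc : obsConst J S.muMax (S.alpha 0) M m δ CG * T ^ 2 ≤ c) (ht : T ≤ t)
    (hE : 0 < energy x t) :
    T * S.muMin * c₀ * ∫ s in T..t, S.rate T δ s ≤ psi c G (energy x 0) (energy x t) := by
  have hT0 : 0 < T := by linarith
  have hδ0 : 0 < δ := by linarith
  have ht0 : 0 ≤ t := hT0.le.trans ht
  have hanti := hx.energy_antitoneOn hS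
  have hle0 : energy x t ≤ energy x 0 := hanti self_mem_Ici ht0 ht0
  have hE0 : 0 < energy x 0 := hE.trans_le hle0
  -- If `μ = 0` the left side vanishes and only `ψ ≥ 0` is needed; the observability argument
  -- requires `μ > 0`.
  rcases S.muMin_nonneg.eq_or_lt with hμ | hμ
  · rw [← hμ]
    simpa using (psi_bijOn hG hδ0 hc0 hE0).mapsTo ⟨hE, hle0⟩
  have hn1 : ⌊t / T⌋₊ * T ≤ t := by
    rw [← le_div_iff₀ hT0]
    exact Nat.floor_le (by positivity)
  have hn2 : t ≤ (⌊t / T⌋₊ + 1 : ℕ) * T := by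
    rw [← div_le_iff₀ hT0]
    push_cast
    exact (Nat.lt_floor_add_one _).le
  have hle : energy x t ≤ energy x (⌊t / T⌋₊ * T) := hanti (mem_Ici.2 (by positivity)) ht0 hn1
  have h := hx.rate_le_psi_nat hS hN hG hg hM hm hδ hCG hc₀ hμ hgen hT hCT hc0 hc ⌊t / T⌋₊
    (hE.trans_le hle)
  have hpsi := (psi_strictAntiOn hG hδ0 hc0 hE0).antitoneOn hE (hE.trans_le hle) hle
  have i1 := hN.intervalIntegrable_rate hT0.le (by linarith : 1 ≤ δ) le_rfl ht
  have i2 := hN.intervalIntegrable_rate hT0.le (by linarith : 1 ≤ δ) ht (ht.trans hn2)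
  have hnn := hN.integral_rate_nonneg (δ := δ) hT0.le ht hn2
  rw [← intervalIntegral.integral_add_adjacent_intervals i1 i2] at h
  have hk : 0 ≤ T * S.muMin * c₀ := by positivity
  nlinarith [mul_nonneg hk hnn]

end DampedSystem

/-! ### Lower bounds of the rate integral for power laws. -/

section PowerLaw

/-- For `α(t) = (1 + t)^σ` the rate is bounded below by a multiple of `(1 + s)^{-σ(δ - 1)}`. -/
theorem rpow_rate_ge {T σ δ s : ℝ} (hT : 0 ≤ T) (hσ : 0 < σ) (hs : T ≤ s) :
    (1 + T) ^ (-σ) * (1 + s) ^ (-(σ * (δ - 1))) ≤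
      (1 + (s - T)) ^ σ * ((1 + s) ^ σ) ^ (-δ) := by
  have h1s : 0 < 1 + s := by linarith
  have h1T : 0 < 1 + T := by linarith
  -- Equality holds at `s = T`, and the right side has the larger slope.
  have h : (1 + T)⁻¹ * (1 + s) ≤ 1 + (s - T) := by
    rw [inv_mul_le_iff₀ h1T]
    nlinarith
  have h2 := Real.rpow_le_rpow (by positivity) h hσ.le
  rw [Real.mul_rpow (by positivity) h1s.le, Real.inv_rpow h1T.le, ← Real.rpow_neg h1T.le] at h2
  rw [← Real.rpow_mul h1s.le]
  have e : (1 + s) ^ (-(σ * (δ - 1))) = (1 + s) ^ σ * (1 + s) ^ (σ * -δ) := by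
    rw [← Real.rpow_add h1s]
    congr 1
    ring
  rw [e, ← mul_assoc]
  gcongr

theorem log_le_integral_rate {T σ δ t : ℝ} (hT : 0 ≤ T) (hσ : 0 < σ) (hγ : σ * (δ - 1) ≤ 1)
    (ht : T ≤ t) {f : ℝ → ℝ} (hf : IntervalIntegrable f volume T t)
    (hfs : ∀ s, T ≤ s → f s = (1 + (s - T)) ^ σ * ((1 + s) ^ σ) ^ (-δ)) :
    (1 + T) ^ (-σ) * (Real.log (1 + t) - Real.log (1 + T)) ≤ ∫ s in T..t, f s := by
  have h1T : 0 < 1 + T := by linarith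
  have h1t : 0 < 1 + t := by linarith
  have e : Real.log (1 + t) - Real.log (1 + T) = ∫ s in T..t, (1 + s)⁻¹ := by
    rw [intervalIntegral.integral_comp_add_left (fun s => s⁻¹), integral_inv_of_pos h1T h1t,
      Real.log_div h1t.ne' h1T.ne']
  rw [e, ← intervalIntegral.integral_const_mul]
  refine intervalIntegral.integral_mono_on ht ?_ hf fun s hs => ?_
  · refine (intervalIntegral.intervalIntegrable_inv (fun s hs => ?_) (by fun_prop)).const_mul _
    rw [uIcc_of_le ht] at hs
    linarith [hs.1]
  · rw [hfs s hs.1]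
    refine le_trans ?_ (rpow_rate_ge hT hσ hs.1)
    gcongr
    rw [← Real.rpow_neg_one]
    exact Real.rpow_le_rpow_of_exponent_le (by linarith [hs.1]) (by linarith)

/-- The lower bound of the integrand is replaced by its value at the right end; `t ≥ 2T` makes the
interval at least `t / 2` long. -/
theorem rpow_le_integral_rate {T σ δ t : ℝ} (hT : 1 ≤ T) (hσ : 0 < σ) (hδ : 1 ≤ δ)
    (hγ : σ * (δ - 1) ≤ 1) (ht : 2 * T ≤ t) {f : ℝ → ℝ} (hf : IntervalIntegrable f volume T t)
    (hfs : ∀ s, T ≤ s → f s = (1 + (s - T)) ^ σ * ((1 + s) ^ σ) ^ (-δ)) :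
    (1 + T) ^ (-σ) / 4 * t ^ (1 - σ * (δ - 1)) ≤ ∫ s in T..t, f s := by
  set γ := σ * (δ - 1) with hγdef
  have hγ0 : 0 ≤ γ := mul_nonneg hσ.le (by linarith)
  have ht0 : 0 < t := by linarith
  have hTt : T ≤ t := by linarith
  have h1T : 0 < 1 + T := by linarith
  have h := intervalIntegral.integral_mono_on hTt intervalIntegrable_const hf
    (f := fun _ => (1 + T) ^ (-σ) * (1 + t) ^ (-γ)) fun s hs => by
      rw [hfs s hs.1]
      refine le_trans ?_ (rpow_rate_ge (by linarith) hσ hs.1)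
      gcongr ?_ * ?_
      exact Real.rpow_le_rpow_of_nonpos (by linarith [hs.1]) (by linarith [hs.2]) (by linarith)
  rw [intervalIntegral.integral_const, smul_eq_mul] at h
  refine le_trans ?_ h
  have h2 : (1 : ℝ) / 2 * t ^ (-γ) ≤ (1 + t) ^ (-γ) := by
    have h3 : (2 * t) ^ (-γ) ≤ (1 + t) ^ (-γ) :=
      Real.rpow_le_rpow_of_nonpos (by linarith) (by linarith) (by linarith)
    refine le_trans ?_ h3
    rw [Real.mul_rpow (by norm_num) ht0.le]
    gcongr
    calc (1 : ℝ) / 2 = 2 ^ (-1 : ℝ) := by rw [Real.rpow_neg_one]; norm_num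
      _ ≤ 2 ^ (-γ) := Real.rpow_le_rpow_of_exponent_le (by norm_num) (by linarith)
  have e : t ^ (1 - γ) = t * t ^ (-γ) := by
    rw [sub_eq_add_neg, Real.rpow_add ht0, Real.rpow_one]
  rw [e]
  calc (1 + T) ^ (-σ) / 4 * (t * t ^ (-γ))
      = t / 2 * ((1 + T) ^ (-σ) * (1 / 2 * t ^ (-γ))) := by ring
    _ ≤ (t - T) * ((1 + T) ^ (-σ) * (1 + t) ^ (-γ)) := by
        gcongr
        · linarith

end PowerLaw

/-! ### From growth of `ψ(E)` to decay of `E`. -/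

section Decay

variable {G E V : ℝ → ℝ} {δ CG c T : ℝ}

theorem tendsto_zero_of_le_psi (hG : IsGrowthFunction G δ CG) (hδ : 0 < δ) (hc : 0 < c)
    (hE : ∀ t, 0 ≤ E t) (hE0 : ∀ t ≥ T, E t ≤ E 0) (hV : Tendsto V atTop atTop)
    (hEV : ∀ t ≥ T, 0 < E t → V t ≤ psi c G (E 0) (E t)) : Tendsto E atTop (𝓝 0) := by
  rw [tendsto_order]
  refine ⟨fun a ha => Eventually.of_forall fun t => ha.trans_le (hE t), fun ε hε => ?_⟩
  filter_upwards [hV.eventually_gt_atTop (psi c G (E 0) ε), eventually_ge_atTop T] with t ht htT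
  by_contra! h
  have hEt := hε.trans_le h
  have h1 := (psi_strictAntiOn hG hδ hc (hEt.trans_le (hE0 t htT))).antitoneOn hε hEt h
  linarith [hEV t htT hEt]

/-- Since `1 / p` decreases, `ψ(e) ≤ E₀ / p(e) ≤ E₀ / (k e^(δ/2))`; comparing with `κ t^ν` and
solving for `e` gives the exponent `2ν / δ`. Only `K` depends on `E₀`. -/
theorem exists_rpow_bound (hG : IsGrowthFunction G δ CG) (hδ : 2 ≤ δ) (hCG : 0 < CG)
    (hc : 0 < c) (hT : 1 ≤ T) {κ ν E₀ : ℝ} (hκ : 0 < κ) (hν : 0 < ν) (hE₀ : 0 < E₀)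
    (hV : ∀ t ≥ 2 * T, κ * t ^ ν ≤ V t) :
    ∃ K > 0, ∀ E : ℝ → ℝ, (∀ t, 0 ≤ E t) → (∀ t ≥ T, E t ≤ E₀) →
      (∀ t ≥ T, 0 < E t → V t ≤ psi c G E₀ (E t)) →
      ∀ t ≥ T, E t ≤ K * t ^ (-(ν * (2 / δ))) := by
  have hδ0 : 0 < δ := by linarith
  obtain ⟨k₁, hk₁, hk₁p⟩ := exists_rpow_le_pFun hG hδ hCG hc
  -- The second entry extends the power bound to all of `(0, E₀]`: for `s ≥ h(1)` one has `p(s) ≥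
  -- 1`.
  set k := min k₁ ((E₀ ^ (δ / 2))⁻¹) with hk
  have hk0 : 0 < k := lt_min hk₁ (by positivity)
  have hp : ∀ s, 0 < s → s ≤ E₀ → k * s ^ (δ / 2) ≤ pFun c G s := fun s hs hsE => by
    rcases le_total s (hFun c G 1) with h | h
    · exact le_trans (by gcongr; exact min_le_left _ _) (hk₁p s hs h)
    · rw [← le_pFun_iff hG hδ0 hc hs.le zero_le_one] at h
      refine le_trans ?_ h
      calc k * s ^ (δ / 2) ≤ (E₀ ^ (δ / 2))⁻¹ * E₀ ^ (δ / 2) := by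
            gcongr
            exact min_le_right _ _
        _ = 1 := inv_mul_cancel₀ (by positivity)
  set r := ν * (2 / δ) with hr
  have hr0 : 0 < r := by positivity
  set D := E₀ / (k * κ) with hD
  have hD0 : 0 < D := by positivity
  refine ⟨D ^ (2 / δ) + E₀ * (2 * T) ^ r, by positivity, fun E hE hEE hEV t ht => ?_⟩
  have ht0 : 0 < t := by linarith
  rcases (hE t).eq_or_lt with h0 | h0
  · rw [← h0]
    positivity
  rcases le_total t (2 * T) with h2 | h2
  · have h3 : 1 ≤ (2 * T) ^ r * t ^ (-r) := by
      rw [Real.rpow_neg ht0.le, ← div_eq_mul_inv, one_le_div (by positivity)]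
      gcongr
    calc E t ≤ E₀ * 1 := by rw [mul_one]; exact hEE t ht
      _ ≤ E₀ * ((2 * T) ^ r * t ^ (-r)) := by gcongr
      _ = E₀ * (2 * T) ^ r * t ^ (-r) := by ring
      _ ≤ _ := by
        gcongr
        exact le_add_of_nonneg_left (by positivity)
  · have hpE := pFun_pos hG hδ0 hc h0
    have h3 := psi_sub_psi_le_div_pFun hG hδ0 hc h0 (hEE t ht) hE₀
    rw [psi_self, sub_zero] at h3
    have h4 : κ * t ^ ν ≤ E₀ / (k * E t ^ (δ / 2)) := by
      refine ((hV t h2).trans (hEV t ht h0)).trans (h3.trans ?_)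
      gcongr
      · linarith
      · exact hp _ h0 (hEE t ht)
    rw [le_div_iff₀ (by positivity)] at h4
    have h5 : E t ^ (δ / 2) ≤ D * t ^ (-ν) := by
      rw [Real.rpow_neg ht0.le, hD, ← div_eq_mul_inv, div_div, le_div_iff₀ (by positivity)]
      linarith
    have h6 := Real.rpow_le_rpow (by positivity) h5 (z := 2 / δ) (by positivity)
    rw [← Real.rpow_mul h0.le, show δ / 2 * (2 / δ) = 1 by field_simp, Real.rpow_one,
      Real.mul_rpow hD0.le (by positivity), ← Real.rpow_mul ht0.le, neg_mul] at h6
    refine h6.trans ?_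
    gcongr
    exact le_add_of_nonneg_right (by positivity)

/-- If `p` is bounded below linearly, `ψ` grows at most logarithmically near `0`, so logarithmic
growth of `V` already gives a power. Here `k` enters the exponent, so it must not depend on `E₀`. -/
theorem exists_rpow_bound_of_log {k : ℝ} (hG : IsGrowthFunction G δ CG) (hδ : 0 < δ)
    (hc : 0 < c) (hT : 1 ≤ T) (hk : 0 < k)
    (hkp : ∀ s, 0 < s → s ≤ hFun c G 1 → k * s ≤ pFun c G s) {κ E₀ : ℝ} (hκ : 0 < κ)
    (hE₀ : 0 < E₀) (hV : ∀ t ≥ T, κ * (Real.log (1 + t) - Real.log (1 + T)) ≤ V t) :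
    ∃ K > 0, ∀ E : ℝ → ℝ, (∀ t, 0 ≤ E t) → (∀ t ≥ T, E t ≤ E₀) →
      (∀ t ≥ T, 0 < E t → V t ≤ psi c G E₀ (E t)) →
      ∀ t ≥ T, E t ≤ K * t ^ (-(k * κ)) := by
  have hh : 0 < hFun c G 1 := by
    rw [← hFun_zero (c := c) hG]
    exact hFun_strictMonoOn hG hc self_mem_Ici (mem_Ici.2 zero_le_one) one_pos
  -- The linear bound is used only below `s₀`; the part of `ψ` above `s₀` is the constant `Q`, which
  -- affects `K` but not the exponent.
  set s₀ := min (hFun c G 1) E₀ with hs₀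
  have hs₀0 : 0 < s₀ := lt_min hh hE₀
  have hs₀E : s₀ ≤ E₀ := min_le_right _ _
  set Q := psi c G E₀ s₀ with hQ
  have hQ0 : 0 ≤ Q := (psi_bijOn hG hδ hc hE₀).mapsTo ⟨hs₀0, hs₀E⟩
  have hanti := (psi_strictAntiOn hG hδ hc hE₀).antitoneOn
  have hpsi : ∀ e, 0 < e → e ≤ E₀ → k * psi c G E₀ e ≤ k * Q + (Real.log E₀ - Real.log e) := by
    intro e he heE
    rcases le_total e s₀ with h | h
    · have h1 : psi c G E₀ e - Q ≤ k⁻¹ * (Real.log s₀ - Real.log e) := by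
        rw [hQ, psi_sub_psi hG hδ hc he hs₀0 hE₀, ← Real.log_div hs₀0.ne' he.ne',
          ← integral_inv_of_pos he hs₀0, ← intervalIntegral.integral_const_mul]
        refine intervalIntegral.integral_mono_on h
          (intervalIntegrable_one_div_pFun hG hδ hc he hs₀0) ?_ fun s hs => ?_
        · refine (intervalIntegral.intervalIntegrable_inv (fun s hs => ?_)
            continuousOn_id).const_mul _
          exact ((lt_min he hs₀0).trans_le hs.1).ne'
        · have hs0 := he.trans_le hs.1
          rw [← mul_inv, ← one_div]
          exact one_div_le_one_div_of_le (by positivity)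
            (hkp s hs0 (hs.2.trans (min_le_left _ _)))
      rw [← div_eq_inv_mul, le_div_iff₀ hk] at h1
      have h2 := Real.log_le_log hs₀0 hs₀E
      linarith
    · have h1 := mul_le_mul_of_nonneg_left (hanti hs₀0 he h) hk.le
      have h2 := Real.log_le_log he heE
      linarith
  refine ⟨Real.exp (Real.log E₀ + k * Q + k * κ * Real.log (1 + T)), Real.exp_pos _,
    fun E hE hEE hEV t ht => ?_⟩
  have ht0 : 0 < t := by linarith
  rcases (hE t).eq_or_lt with h0 | h0
  · rw [← h0]
    positivity
  rw [Real.rpow_def_of_pos ht0, ← Real.exp_add, ← Real.log_le_iff_le_exp h0]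
  have h1 := mul_le_mul_of_nonneg_left ((hV t ht).trans (hEV t ht h0)) hk.le
  have h2 := hpsi _ h0 (hEE t ht)
  have h3 : k * κ * Real.log t ≤ k * κ * Real.log (1 + t) := by
    gcongr
    linarith
  linarith

end Decay

end Damping

end

/-! ### Choice of constants and conclusion. -/

theorem mainTheorem2
    (C ω : ℝ) (hC : 0 < C) (hω : 0 < ω) :
    ∃ T₀ > (0 : ℝ), ∀ T ≥ T₀,
    ∀ (J : ℕ) (μmax a₀ c₀ M m δ CG : ℝ),
      1 ≤ J → 0 < c₀ → c₀ ≤ 1 → 0 < M → 0 < m → 2 ≤ δ → 0 < CG →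
    ∃ c > (0 : ℝ),
    ∀ (H : Type u) [NormedAddCommGroup H] [InnerProductSpace ℝ H] [CompleteSpace H]
      (V : Type v) [NormedAddCommGroup V] [InnerProductSpace ℝ V] [CompleteSpace V]
      (X : Fin J → Type w) [∀ j, MetricSpace (X j)] [∀ j, MeasurableSpace (X j)]
      [∀ j, OpensMeasurableSpace (X j)]
      (S : Damping.DampedSystem H V X) (G : ℝ → ℝ),
      S.Standing M →
      S.StableGeneration C ω →
      Damping.IsGrowthFunction G δ CG →
      (∀ j, Damping.IsControlledBy (S.g j) m G) →
      S.NonDecreasing c₀ →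
      S.muMax = μmax →
      S.alpha 0 = a₀ →
      -- the functions in the bound are well defined
      (BijOn (Damping.hFun c G) (Ici 0) (Ici 0) ∧
        (∀ E₀ > (0 : ℝ),
          (∀ r > (0 : ℝ), IntervalIntegrable (fun s => 1 / Damping.pFun c G s) volume r E₀) ∧
          BijOn (Damping.psi c G E₀) (Ioc 0 E₀) (Ici 0)) ∧
        (∀ t ≥ T, IntervalIntegrable
          (fun s => S.alpha (s - T) * S.alpha s ^ (-δ)) volume T t)) ∧
      -- the decay estimate
      (∀ x : ℝ → H, S.IsSolution x → ∀ t ≥ T,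
        Damping.energy x t ≤ Damping.psiInv c G (Damping.energy x 0)
          (T * S.muMin * c₀ * ∫ s in T..t, S.alpha (s - T) * S.alpha s ^ (-δ))) ∧
      -- decay for `α(t) = (1 + t) ^ σ`
      (∀ σ > (0 : ℝ), 0 < S.muMin → (∀ t ≥ (0 : ℝ), S.alpha t = (1 + t) ^ σ) →
        (σ ≤ 1 / (δ - 1) →
          ∀ x : ℝ → H, S.IsSolution x → Tendsto (Damping.energy x) atTop (𝓝 0)) ∧
        (σ < 1 / (δ - 1) ∨ (δ = 2 ∧ σ = 1) →
          ∃ r > (0 : ℝ), ∀ E₀ : ℝ, ∃ K > (0 : ℝ), ∀ x : ℝ → H, S.IsSolution x → Damping.energy x 0 = E₀ →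
            ∀ t ≥ T, Damping.energy x t ≤ K * t ^ (-r))) := by
  -- The logarithm is the time at which `C e^(-ωT)` reaches `1 / 4`; `T ≥ 1` is needed for `G(T Y) ≤
  -- T G(Y)`.
  refine ⟨max 1 (Real.log (4 * C) / ω), by positivity, fun T hTT => ?_⟩
  have hT : 1 ≤ T := (le_max_left _ _).trans hTT
  have hT0 : 0 < T := by linarith
  have hCT : C * Real.exp (-ω * T) ≤ 1 / 4 := by
    have h1 := (le_max_right _ _).trans hTT
    rw [div_le_iff₀ hω, Real.log_le_iff_le_exp (by positivity)] at h1
    rw [neg_mul, Real.exp_neg, ← div_eq_mul_inv, div_le_iff₀ (Real.exp_pos _), mul_comm ω]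
    linarith
  intro J μmax a₀ c₀ M m δ CG _ hc₀ _ hM hm hδ hCG
  have hδ0 : 0 < δ := by linarith
  -- At this point `μmax` and `a₀` are arbitrary reals, so the absolute value and the `+ 1` secure
  -- `c > 0`. The constant does not involve `G`.
  set c := |Damping.DampedSystem.obsConst J μmax a₀ M m δ CG| * T ^ 2 + 1 with hcdef
  have hc : 0 < c := by positivity
  refine ⟨c, hc, ?_⟩
  intro H _ _ _ V _ _ _ X _ _ _ S G hS hgen hG hg hN hμmax ha₀
  have hobs : Damping.DampedSystem.obsConst J S.muMax (S.alpha 0) M m δ CG * T ^ 2 ≤ c := by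
    rw [hμmax, ha₀, hcdef]
    have := mul_le_mul_of_nonneg_right
      (le_abs_self (Damping.DampedSystem.obsConst J μmax a₀ M m δ CG)) (sq_nonneg T)
    linarith
  have hrate : ∀ t ≥ T, IntervalIntegrable
      (fun s => S.alpha (s - T) * S.alpha s ^ (-δ)) volume T t := fun t ht =>
    hN.intervalIntegrable_rate hT0.le (by linarith) le_rfl ht
  have hdom : ∀ x : ℝ → H, S.IsSolution x → ∀ t ≥ T, Damping.energy x t ≤ Damping.energy x 0 := by
    intro x hx t ht
    obtain ⟨y, Z, hxy⟩ := hx.exists_isSolutionWith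
    exact hxy.energy_antitoneOn hS self_mem_Ici (mem_Ici.2 (hT0.le.trans ht)) (hT0.le.trans ht)
  have hmain : ∀ x : ℝ → H, S.IsSolution x → ∀ t ≥ T, 0 < Damping.energy x t →
      T * S.muMin * c₀ * ∫ s in T..t, S.alpha (s - T) * S.alpha s ^ (-δ) ≤
        Damping.psi c G (Damping.energy x 0) (Damping.energy x t) := by
    intro x hx t ht hE
    obtain ⟨y, Z, hxy⟩ := hx.exists_isSolutionWith
    exact hxy.rate_le_psi hS hN hG hg hM hm hδ hCG hc₀ hgen hT hCT hc hobs ht hE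
  refine ⟨⟨Damping.hFun_bijOn hG hδ0 hc, fun E₀ hE₀ => ⟨fun r hr =>
    Damping.intervalIntegrable_one_div_pFun hG hδ0 hc hr hE₀,
    Damping.psi_bijOn hG hδ0 hc hE₀⟩, hrate⟩, ?_, ?_⟩
  · intro x hx t ht
    have hle := hdom x hx t ht
    rcases (Damping.energy_nonneg x 0).eq_or_lt with h0 | h0
    · rw [Damping.psiInv, if_pos h0.symm]
      linarith
    have hv : 0 ≤ T * S.muMin * c₀ * ∫ s in T..t, S.alpha (s - T) * S.alpha s ^ (-δ) := by
      have h1 := hN.integral_rate_nonneg (δ := δ) hT0.le le_rfl ht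
      have h2 := S.muMin_nonneg
      exact mul_nonneg (by positivity) h1
    rcases (Damping.energy_nonneg x t).eq_or_lt with h1 | h1
    · rw [← h1]
      exact (Damping.psiInv_mem hG hδ0 hc h0 hv).1.1.le
    · exact Damping.le_psiInv_of_le_psi hG hδ0 hc h0 hv h1 (hmain x hx t ht h1)
  · intro σ hσ hμ hα
    set V : ℝ → ℝ := fun t =>
      T * S.muMin * c₀ * ∫ s in T..t, S.alpha (s - T) * S.alpha s ^ (-δ) with hV
    have hk : 0 < T * S.muMin * c₀ := by positivity
    have h1T : 0 < (1 + T) ^ (-σ) := Real.rpow_pos_of_pos (by linarith) _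
    have hf : ∀ s, T ≤ s → S.alpha (s - T) * S.alpha s ^ (-δ) =
        (1 + (s - T)) ^ σ * ((1 + s) ^ σ) ^ (-δ) := fun s hs => by
      rw [hα _ (sub_nonneg.2 hs), hα _ (hT0.le.trans hs)]
    have hVlog : σ * (δ - 1) ≤ 1 → ∀ t ≥ T, T * S.muMin * c₀ * (1 + T) ^ (-σ) *
        (Real.log (1 + t) - Real.log (1 + T)) ≤ V t := fun hγ t ht => by
      rw [mul_assoc]
      exact mul_le_mul_of_nonneg_left
        (Damping.log_le_integral_rate hT0.le hσ hγ ht (hrate t ht) hf) hk.le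
    refine ⟨fun hσδ x hx => ?_, fun hσδ => ?_⟩
    · rw [le_div_iff₀ (by linarith)] at hσδ
      refine Damping.tendsto_zero_of_le_psi (V := V) hG hδ0 hc (Damping.energy_nonneg x)
        (hdom x hx) ?_ (hmain x hx)
      refine tendsto_atTop_mono' atTop
        (by filter_upwards [eventually_ge_atTop T] with t ht using hVlog hσδ t ht) ?_
      refine Tendsto.const_mul_atTop (by positivity) (tendsto_atTop_add_const_right _ _ ?_)
      exact Real.tendsto_log_atTop.comp (tendsto_atTop_add_const_left _ _ tendsto_id)
    · have hfinish : ∀ r : ℝ,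
          (∀ E₀ > 0, ∃ K > 0, ∀ E : ℝ → ℝ, (∀ t, 0 ≤ E t) → (∀ t ≥ T, E t ≤ E₀) →
            (∀ t ≥ T, 0 < E t → V t ≤ Damping.psi c G E₀ (E t)) →
            ∀ t ≥ T, E t ≤ K * t ^ (-r)) →
          ∀ E₀ : ℝ, ∃ K > (0 : ℝ), ∀ x : ℝ → H, S.IsSolution x → Damping.energy x 0 = E₀ →
            ∀ t ≥ T, Damping.energy x t ≤ K * t ^ (-r) := by
        intro r hr E₀
        rcases le_or_gt E₀ 0 with h0 | h0
        · refine ⟨1, one_pos, fun x hx hx0 t ht => ?_⟩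
          have h1 := hdom x hx t ht
          have h2 : 0 < t ^ (-r) := Real.rpow_pos_of_pos (hT0.trans_le ht) _
          linarith
        · obtain ⟨K, hK, hKE⟩ := hr E₀ h0
          refine ⟨K, hK, fun x hx hx0 => ?_⟩
          subst hx0
          exact hKE _ (Damping.energy_nonneg x) (hdom x hx) (hmain x hx)
      rcases hσδ with hσδ | ⟨rfl, rfl⟩
      · rw [lt_div_iff₀ (by linarith)] at hσδ
        have hν : 0 < 1 - σ * (δ - 1) := by linarith
        refine ⟨(1 - σ * (δ - 1)) * (2 / δ), by positivity, hfinish _ fun E₀ hE₀ => ?_⟩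
        refine Damping.exists_rpow_bound (κ := T * S.muMin * c₀ * ((1 + T) ^ (-σ) / 4))
          hG hδ hCG hc hT (by positivity) hν hE₀ fun t ht => ?_
        rw [mul_assoc]
        exact mul_le_mul_of_nonneg_left (Damping.rpow_le_integral_rate hT hσ (by linarith) hσδ.le
          ht (hrate t (by linarith)) hf) hk.le
      -- In the borderline case `σ(δ - 1) = 1` the rate integral is only bounded below by a
      -- logarithm, but `δ / 2 = 1` makes the lower bound of `p` linear.
      · obtain ⟨k, hk0, hkp⟩ := Damping.exists_rpow_le_pFun hG hδ hCG hc
        refine ⟨k * (T * S.muMin * c₀ * (1 + T) ^ (-1 : ℝ)), by positivity,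
          hfinish _ fun E₀ hE₀ => ?_⟩
        refine Damping.exists_rpow_bound_of_log hG hδ0 hc hT hk0 (fun s hs hs1 => ?_)
          (by positivity) hE₀ (hVlog (by norm_num))
        simpa using hkp s hs hs1
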